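/- Let $P$ be a finite simplicial poset, i.e. a finite poset with least element $\hat 0$ such that every interval $[\hat 0,y]$ is a Boolean lattice. Let $x_1,\dots,x_n$ be its atoms, and for $y\in P$ put $\operatorname{supp}(y)=\{j: x_j\preceq y\}$ and $\operatorname{cost}_P(y)=\{w\in P: y\npreceq w\}$. For $w,y\in P$ let $\mathcal M(w,y)$ be the set of minimal upper bounds of $w$ and $y$. Let $k$ be a field, $A=k[x_1,\dots,x_n]$, $\mathfrak m=(x_1,\dots,x_n)$, and let $A_P=k[y: y\in P]/I_P$ be the face ring of $P$, where $I_P$ is generated by $\hat 0-1$, by the products $wy$ with $\mathcal M(w,y)=\emptyset$, and by the elements $wy-(w\wedge y)\sum_{z\in\mathcal M(w,y)}z$ with $\mathcal M(w,y)\neq\emptyset$. Consider $A_P$ as a $\mathbb Z^n$-graded $A$-module, with $\deg(y)=\sum_{j\in\operatorname{supp}(y)}\mathbf e_j$, and let $H^i_{\mathfrak m}(A_P)$ be its $i$-th local cohomology module, that is, the cohomology of the Čech complex of $A_P$ on $x_1,\dots,x_n$, with the induced $\mathbb Z^n$-grading. For an order ideal $Q$ of $P$ let $C^i(P,Q)$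 be the $k$-vector space with basis the elements of $P\smallsetminus Q$ of rank $i+1$, and fix an orientation $\mathcal O$ of $P$, i.e. a partial order on $\{1,\dots,n\}$ that is total on the support of every face. Let $H^i(P,Q)$ be the cohomology of $C^\bullet(P,Q)$ with respect to $$\delta(y)=\sum_{j\notin\operatorname{supp}(y)}(-1)^{u_j}\sum_{z\in\mathcal M(x_j,y)}z,\qquad u_j=|\{l\in\operatorname{supp}(y): j<_{\mathcal O}l\}|.$$ (For $Q=\operatorname{cost}_P(\hat 0)=\emptyset$ this is the reduced cohomology of $P$.) For $\alpha\in\mathbb Z^n$ put $\operatorname{supp}(\alpha)=\{j:\alpha_j\ne 0\}$. Then for every $i$ the following holds. If $\alpha\in\mathbb Z^n$ and $\alpha\notin\mathbb Z^n_{\le 0}$, then $H^i_{\mathfrak m}(A_P)_\alpha=0$. There are $k$-linear isomorphisms, one for each $\alpha\in\mathbb Z^n_{\le 0}$, $$H^i_{\mathfrak m}(A_P)_\alpha\;\cong\bigoplus_{\operatorname{supp}(w)=\operatorname{supp}(\alpha)}H^{i-1}(P,\operatorname{cost}_P(w)),$$ under which the $A$-module structure of $H^i_{\mathfrak m}(A_P)$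 is as follows. Let $1\le j\le n$ and $\gamma=\alpha+\mathbf e_j$. - If $\alpha\in\mathbb Z^n_{\le 0}$ and $\alpha_j<-1$, then $\cdot x_j:H^i_{\mathfrak m}(A_P)_\alpha\to H^i_{\mathfrak m}(A_P)_\gamma$ corresponds to the direct sum of the identity maps of the $H^{i-1}(P,\operatorname{cost}_P(w))$. - If $\alpha\in\mathbb Z^n_{\le 0}$ and $\alpha_j=-1$, then $\cdot x_j$ corresponds to the direct sum of the maps $H^{i-1}(P,\operatorname{cost}_P(w))\to H^{i-1}(P,\operatorname{cost}_P(w\smallsetminus x_j))$ induced by the inclusions of pairs $(P,\operatorname{cost}_P(w\smallsetminus x_j))\to(P,\operatorname{cost}_P(w))$, where $w\smallsetminus x_j$ is the unique face below $w$ with support $\operatorname{supp}(w)\smallsetminus\{j\}$. - If $\alpha\in\mathbb Z^n$ and $\alpha_j\ge 0$, then $\cdot x_j$ is zero on $H^i_{\mathfrak m}(A_P)_\alpha$. -/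

import Mathlib

open scoped DirectSum

namespace SimplicialPoset

noncomputable section

/-! ### Simplicial posets -/

section Combinatorics

variable {P : Type*} [PartialOrder P]

/-- A (finite) poset with least element `⊥` is simplicial if every interval `[⊥, y]` is a
finite Boolean lattice. -/
def IsSimplicialPoset (P : Type*) [PartialOrder P] [OrderBot P] : Prop :=
  ∀ y : P, ∃ r : ℕ, Nonempty (Set.Icc (⊥ : P) y ≃o Finset (Fin r))

/-- The rank of `y`: the maximal length of a chain ending at `y`. -/
def rk (y : P) : ℕ := (Order.height y).toNat

/-- The contrastar of `y`: the order ideal of all faces `w` with `¬ y ≤ w`. -/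
def cost (y : P) : LowerSet P where
  carrier := {w | ¬ y ≤ w}
  lower' := fun _ _ hba ha hb => ha (hb.trans hba)

/-- If `z ≤ w` then `cost z` is contained in `cost w`. -/
theorem cost_mono {z w : P} (h : z ≤ w) : cost z ≤ cost w :=
  fun _ hv hwv => hv (h.trans hwv)

open Classical in
/-- The set `M(w, y)` of minimal upper bounds of `w` and `y`. -/
def minUpper [Fintype P] (w y : P) : Finset P :=
  {z | Minimal (fun u => w ≤ u ∧ y ≤ u) z}

variable [OrderBot P] {n : ℕ}

open Classical in
/-- The support of a face `y`, with respect to a labelling `x` of the atoms (vertices). -/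
def supp (x : Fin n ≃ {a : P // IsAtom a}) (y : P) : Finset (Fin n) :=
  {i | (x i : P) ≤ y}

/-- The support of a degree `α ∈ ℤⁿ`. -/
def degSupp (α : Fin n → ℤ) : Finset (Fin n) := {i | α i ≠ 0}

/-- An orientation: a partial order on the indices of the vertices that is total on the
support of every face. -/
structure VertexOrientation (x : Fin n ≃ {a : P // IsAtom a}) where
  ord : PartialOrder (Fin n)
  total : ∀ y : P, ∀ i ∈ supp x y, ∀ j ∈ supp x y, ord.le i j ∨ ord.le j i

end Combinatorics

/-! ### Relative cohomology of a pair `(P, Q)` -/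

section RelativeCohomology

variable (k : Type*) [Field k] {P : Type*} [PartialOrder P]

/-- The relative cochains `C^i(P, Q)`: spanned by the faces of rank `i + 1` that are not in `Q`.
For `Q = ∅` this is the reduced (augmented) cochain space of `P`. -/
def relCochains (Q : LowerSet P) (i : ℤ) : Submodule k (P → k) where
  carrier := {f | ∀ y, f y ≠ 0 → y ∉ Q ∧ (rk y : ℤ) = i + 1}
  zero_mem' := fun _ hy => absurd rfl hy
  add_mem' := fun {f g} hf hg y hy => by
    by_cases h : f y = 0
    · exact hg y fun h' => hy (by simp [h, h'])
    · exact hf y h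
  smul_mem' := fun r f hf y hy => hf y fun h => hy (by simp [h])

theorem relCochains_anti {Q Q' : LowerSet P} (h : Q ≤ Q') (i : ℤ) :
    relCochains k Q' i ≤ relCochains k Q i :=
  fun _ hf y hy => ⟨fun hQ => (hf y hy).1 (h hQ), (hf y hy).2⟩

variable [OrderBot P] [Fintype P] {n : ℕ}
  {x : Fin n ≃ {a : P // IsAtom a}} (O : VertexOrientation x)

open Classical in
/-- The coboundary operator
`δ y = ∑_{j ∉ supp y} (-1) ^ #{i ∈ supp y : j < i} ∑_{z ∈ M(x_j, y)} z`
on the vector space with basis `P`. The basis vector of `y` is `Pi.single y 1`. -/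
def coboundary : (P → k) →ₗ[k] (P → k) :=
  Fintype.linearCombination k fun y =>
    ∑ j ∈ (supp x y)ᶜ, (-1 : k) ^ ({i ∈ supp x y | O.ord.lt j i} : Finset (Fin n)).card •
      ∑ z ∈ minUpper (x j : P) y, Pi.single z (1 : k)

/-- The relative cocycles `Z^i(P, Q)`. -/
def relCocycles (Q : LowerSet P) (i : ℤ) : Submodule k (P → k) :=
  relCochains k Q i ⊓ LinearMap.ker (coboundary k O)

/-- The relative coboundaries `B^i(P, Q) = δ (C^{i-1}(P, Q))`. -/
def relCoboundaries (Q : LowerSet P) (i : ℤ) : Submodule k (P → k) :=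
  (relCochains k Q (i - 1)).map (coboundary k O)

/-- The relative cohomology `H^i(P, Q)` with coefficients in `k`. -/
abbrev RelCohomology (Q : LowerSet P) (i : ℤ) : Type _ :=
  relCocycles k O Q i ⧸ (relCoboundaries k O Q i).submoduleOf (relCocycles k O Q i)

theorem relCocycles_anti {Q Q' : LowerSet P} (h : Q ≤ Q') (i : ℤ) :
    relCocycles k O Q' i ≤ relCocycles k O Q i :=
  inf_le_inf_right _ (relCochains_anti k h i)

/-- The map `H^i(P, Q') → H^i(P, Q)` induced by the inclusion of pairs `(P, Q) → (P, Q')`.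
On cochains it is the inclusion of the cochains vanishing on `Q'` into those vanishing on `Q`. -/
def relMap {Q Q' : LowerSet P} (h : Q ≤ Q') (i : ℤ) :
    RelCohomology k O Q' i →ₗ[k] RelCohomology k O Q i :=
  Submodule.mapQ _ _ (Submodule.inclusion (relCocycles_anti k O h i))
    fun _ hc => Submodule.map_mono (relCochains_anti k h (i - 1)) hc

/-- The direct sum of the `H^i(P, cost w)` over all faces `w` with support `S`. -/
abbrev CostSum (S : Finset (Fin n)) (i : ℤ) : Type _ :=
  ⨁ w : {w : P // supp x w = S}, RelCohomology k O (cost (w : P)) i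

open Classical in
/-- The class `c ∈ H^i(P, cost w)`, placed in the summand of `w`. -/
def CostSum.of {S : Finset (Fin n)} {i : ℤ} (w : P) (hw : supp x w = S)
    (c : RelCohomology k O (cost w) i) : CostSum k O S i :=
  DirectSum.lof k {w : P // supp x w = S} (fun w => RelCohomology k O (cost (w : P)) i) ⟨w, hw⟩ c

end RelativeCohomology

/-! ### The face ring -/

section FaceRing

variable (k : Type*) [Field k] {P : Type*} [PartialOrder P] [OrderBot P] [Fintype P] {n : ℕ}

open MvPolynomial in
/-- The ideal `I_P` of `k[P]`. If `w` and `y` have an upper bound, their meet `m` exists. -/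
def faceIdeal (P : Type*) [PartialOrder P] [OrderBot P] [Fintype P] :
    Ideal (MvPolynomial P k) :=
  Ideal.span
    ({f | ∃ w y : P, minUpper w y = ∅ ∧ f = X w * X y} ∪
     {f | ∃ w y m : P, (minUpper w y).Nonempty ∧ IsGLB {w, y} m ∧
        f = X w * X y - X m * ∑ z ∈ minUpper w y, X z} ∪
     {X ⊥ - 1})

/-- The face ring `A_P = k[P] / I_P`. The labelling `x` of the vertices plays no role for the
ring; it determines the structure of an algebra over `A = k[x_1, …, x_n]`. -/
def FaceRing {P : Type*} [PartialOrder P] [OrderBot P] [Fintype P]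
    (_x : Fin n ≃ {a : P // IsAtom a}) : Type _ :=
  MvPolynomial P k ⧸ faceIdeal k P

variable (x : Fin n ≃ {a : P // IsAtom a})

instance : CommRing (FaceRing k x) :=
  inferInstanceAs (CommRing (MvPolynomial P k ⧸ faceIdeal k P))

instance : Algebra k (FaceRing k x) :=
  inferInstanceAs (Algebra k (MvPolynomial P k ⧸ faceIdeal k P))

/-- The quotient map `k[P] → A_P`. -/
def FaceRing.mk : MvPolynomial P k →ₐ[k] FaceRing k x :=
  Ideal.Quotient.mkₐ k (faceIdeal k P)

/-- The structure map `A → A_P`, sending the `i`-th variable to the class of the atom `x i`. -/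
def FaceRing.structureMap : MvPolynomial (Fin n) k →ₐ[k] FaceRing k x :=
  MvPolynomial.aeval fun i => FaceRing.mk k x (MvPolynomial.X (x i : P))

instance : Algebra (MvPolynomial (Fin n) k) (FaceRing k x) :=
  (FaceRing.structureMap k x).toRingHom.toAlgebra

instance : IsScalarTower k (MvPolynomial (Fin n) k) (FaceRing k x) :=
  IsScalarTower.of_algebraMap_eq fun r => ((FaceRing.structureMap k x).commutes r).symm

open Classical in
/-- The degree `∑_{i ∈ supp y} e_i` of a variable `y` of `k[P]`. -/
def faceDegree (y : P) : Fin n → ℤ := fun i => if i ∈ supp x y then 1 else 0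

/-- The `ℤⁿ`-grading of `A_P`: its degree `α` part is the image of the polynomials that are
homogeneous of degree `α`. -/
def FaceRing.grading (α : Fin n → ℤ) : Submodule k (FaceRing k x) :=
  (MvPolynomial.weightedHomogeneousSubmodule k (faceDegree x) α).map (FaceRing.mk k x).toLinearMap

end FaceRing

/-! ### Graded local cohomology at `𝔪 = (x_1, …, x_n)`

For a module `M` over `A = k[x_1, …, x_n]`, `H_𝔪^i(M)` is the cohomology of the Čech complex
`0 → M → ⨁_i M_{x_i} → ⨁_{i<j} M_{x_i x_j} → ⋯ → M_{x_1⋯x_n} → 0`.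
If `M` is `ℤⁿ`-graded then so is every localization `M_{x_F}` at a set of variables. -/

section LocalCohomology

variable (k : Type*) [Field k]

/-- The multiplicative set generated by the variables `x_i`, `i ∈ F`. -/
def varSubmonoid {n : ℕ} (F : Finset (Fin n)) : Submonoid (MvPolynomial (Fin n) k) :=
  Submonoid.closure (MvPolynomial.X '' (F : Set (Fin n)))

theorem varSubmonoid_mono {n : ℕ} {F G : Finset (Fin n)} (h : F ⊆ G) :
    varSubmonoid k F ≤ varSubmonoid k G :=
  Submonoid.closure_mono (Set.image_mono (Finset.coe_subset.mpr h))

variable (n : ℕ) (M : Type*) [AddCommGroup M]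
  [Module (MvPolynomial (Fin n) k) M]

/-- The localization `M_{x_F}`, where the variables `x_i` with `i ∈ F` are inverted. -/
abbrev CechTerm (F : Finset (Fin n)) : Type _ := LocalizedModule (varSubmonoid k F) M

/-- All the terms of the Čech complex together. -/
abbrev CechTotal : Type _ := ∀ F : Finset (Fin n), CechTerm k n M F

/-- The Čech differential
`(d c)_G = ∑_{j ∈ G} (-1) ^ #{i ∈ G : i < j} c_{G ∖ j}|_{M_{x_G}}`. -/
def cechDifferential : CechTotal k n M →ₗ[MvPolynomial (Fin n) k] CechTotal k n M :=
  LinearMap.pi fun G => ∑ j ∈ G, (-1 : MvPolynomial (Fin n) k) ^ {i ∈ G | i < j}.card •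
    (LocalizedModule.liftOfLE (M := M) (varSubmonoid k (G.erase j)) (varSubmonoid k G)
      (varSubmonoid_mono k (Finset.erase_subset j G))) ∘ₗ LinearMap.proj (G.erase j)

/-- The Čech cochains of degree `i`: those concentrated in the terms `M_{x_F}` with `#F = i`. -/
def cechCochains (i : ℤ) : Submodule (MvPolynomial (Fin n) k) (CechTotal k n M) where
  carrier := {c | ∀ F, (F.card : ℤ) ≠ i → c F = 0}
  zero_mem' := fun _ _ => rfl
  add_mem' := fun ha hb F hF => by simp [ha F hF, hb F hF]
  smul_mem' := fun r c hc F hF => by simp [hc F hF]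

/-- The Čech cocycles of degree `i`. -/
def cechCocycles (i : ℤ) : Submodule (MvPolynomial (Fin n) k) (CechTotal k n M) :=
  cechCochains k n M i ⊓ LinearMap.ker (cechDifferential k n M)

/-- The Čech coboundaries of degree `i`. -/
def cechCoboundaries (i : ℤ) : Submodule (MvPolynomial (Fin n) k) (CechTotal k n M) :=
  (cechCochains k n M (i - 1)).map (cechDifferential k n M)

/-- The local cohomology module `H_𝔪^i(M)`, an `A`-module. -/
abbrev LocalCohomology (i : ℤ) : Type _ :=
  cechCocycles k n M i ⧸ (cechCoboundaries k n M i).submoduleOf (cechCocycles k n M i)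

variable [Module k M] [IsScalarTower k (MvPolynomial (Fin n) k) M]

variable {n M} in
/-- The degree `α` part of `M_{x_F}`, for a `ℤⁿ`-grading `𝓜` of `M`: it consists of the elements
`m / x^β` with `β` supported on `F` and `m` homogeneous of degree `α + β`. -/
def cechTermGrading (𝓜 : (Fin n → ℤ) → Submodule k M) (F : Finset (Fin n)) (α : Fin n → ℤ) :
    Submodule k (CechTerm k n M F) :=
  Submodule.span k {u | ∃ β : Fin n →₀ ℕ, β.support ⊆ F ∧ ∃ m ∈ 𝓜 (fun i => α i + β i),
    MvPolynomial.monomial β (1 : k) • u = LocalizedModule.mkLinearMap (varSubmonoid k F) M m}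

variable {n M} in
/-- The degree `α` part `H_𝔪^i(M)_α`, for a `ℤⁿ`-grading `𝓜` of `M`: the classes of the cocycles
all of whose components are homogeneous of degree `α`. -/
def localCohomologyGrading (𝓜 : (Fin n → ℤ) → Submodule k M) (i : ℤ) (α : Fin n → ℤ) :
    Submodule k (LocalCohomology k n M i) :=
  Submodule.span k {h | ∃ z : cechCocycles k n M i,
    (∀ F, (z : CechTotal k n M) F ∈ cechTermGrading k 𝓜 F α) ∧ Submodule.Quotient.mk z = h}

end LocalCohomology

section FaceRingLocalCohomology

variable (k : Type*) [Field k] {P : Type*} [PartialOrder P] [OrderBot P] [Fintype P] {n : ℕ}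
  (x : Fin n ≃ {a : P // IsAtom a})

/-- The local cohomology module `H_𝔪^i(A_P)` over `A = k[x_1, …, x_n]`. -/
abbrev FaceLocalCohomology (i : ℤ) : Type _ := LocalCohomology k n (FaceRing k x) i

/-- The degree `α` part `H_𝔪^i(A_P)_α`. -/
abbrev faceLocalCohomologyDegree (i : ℤ) (α : Fin n → ℤ) :
    Submodule k (FaceLocalCohomology k x i) :=
  localCohomologyGrading k (FaceRing.grading k x) i α

end FaceRingLocalCohomology

end

end SimplicialPoset

open SimplicialPoset

/-! Each face `y` defines a ring map from `A_P` to Laurent polynomials, sending a face `w ≤ y` to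
the squarefree monomial on its support and every other face to `0`. Used as straightening rules, the
relations of `A_P` show that it is spanned by the standard monomials `x^δ w` with `supp δ ⊆ supp w`.
The evaluations separate these (`evalFace_jointly_injective`). The localization at `x_F` is likewise
detected by the evaluations at the faces `y` with `F ⊆ supp y` (`cechEval_jointly_injective`), so
everything can be read off from coefficients.

Let `α ≤ 0`. The degree `α` part of the localization at `x_F` vanishes unless `supp α ⊆ F`, and then
it has a basis of fractions `faceFrac`, one for each face with support `F`. A Čech cochain of degree
`α` is therefore a function on the faces `y` with `supp α ⊆ supp y`. Each such `y` lies above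
exactly one `w` with `supp w = supp α`, so these functions split into the cochains of the pairs `(P,
cost w)`. A face of rank `i` sits in Čech degree `i` but in simplicial degree `i - 1`, which
accounts for the shift. The rule `x_j y = ∑ z`, over `z ∈ M(x_j, y)`, turns the Čech differential
into the coboundary, once `orientSign` reconciles the two sign conventions. The two translations are
`toCech` and `ofCech`; `cechDifferential_toCech`, `ofCech_cechDifferential`, `ofCech_toCech` and
`eq_sum_toCech_ofCech` carry the isomorphism.

If `α_j > 0`, inverting `x_j` is bijective in degree `α`, so that strand of the Čech complex is
acyclic (`exists_cechDifferential_eq`). Finally, for `α_j < 0`, `x_j` cancels one factor of the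
denominator of `faceFrac` and leaves the function on faces unchanged. Multiplication is thus the
inclusion of cochains (`X_smul_relToLocal`). For `α_j ≥ 0` it lands in a degree with a positive
coordinate, hence in zero. -/

namespace SimplicialPoset

noncomputable section

/-! ### Faces of a simplicial poset and their supports -/

section Combinatorics

variable {P : Type*} [PartialOrder P] [OrderBot P] {n : ℕ}

theorem mem_supp {x : Fin n ≃ {a : P // IsAtom a}} {y : P} {i : Fin n} :
    i ∈ supp x y ↔ (x i : P) ≤ y := by
  simp [supp]

theorem supp_mono {x : Fin n ≃ {a : P // IsAtom a}} {w y : P} (h : w ≤ y) :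
    supp x w ⊆ supp x y :=
  fun _ hi => mem_supp.2 ((mem_supp.1 hi).trans h)

theorem supp_bot (x : Fin n ≃ {a : P // IsAtom a}) : supp x (⊥ : P) = ∅ := by
  ext i
  simp only [mem_supp, le_bot_iff, Finset.notMem_empty, iff_false]
  exact (x i).2.1

theorem supp_atom (x : Fin n ≃ {a : P // IsAtom a}) (j : Fin n) : supp x (x j : P) = {j} := by
  ext i
  rw [mem_supp, Finset.mem_singleton, (x j).2.le_iff]
  constructor
  · rintro (h | h)
    · exact absurd h (x i).2.1
    · exact x.injective (Subtype.ext h)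
  · rintro rfl
    exact Or.inr rfl

/-- An order isomorphism of `[⊥, y]` with a Boolean lattice sends the vertices of `y` to
singletons. -/
theorem orderIso_atom {y : P} {r : ℕ} (e : Set.Icc (⊥ : P) y ≃o Finset (Fin r)) {a : P}
    (ha : IsAtom a) (hay : a ≤ y) : ∃ c, e ⟨a, bot_le, hay⟩ = {c} := by
  let _ : OrderBot (Set.Icc (⊥ : P) y) := { bot := ⟨⊥, le_rfl, bot_le⟩, bot_le := fun b => b.2.1 }
  have h : IsAtom (e ⟨a, bot_le, hay⟩) := by
    rw [e.isAtom_iff]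
    exact ⟨fun h => ha.1 (congrArg Subtype.val h), fun b hb => Subtype.ext (ha.2 b.1 hb)⟩
  exact Finset.isAtom_iff.1 h

theorem orderIso_symm_singleton {y : P} {r : ℕ} (e : Set.Icc (⊥ : P) y ≃o Finset (Fin r))
    (c : Fin r) : IsAtom ((e.symm {c} : Set.Icc (⊥ : P) y) : P) := by
  let _ : OrderBot (Set.Icc (⊥ : P) y) := { bot := ⟨⊥, le_rfl, bot_le⟩, bot_le := fun b => b.2.1 }
  have h : IsAtom (e.symm {c}) := by
    rw [e.symm.isAtom_iff]
    exact Finset.isAtom_singleton c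
  refine ⟨fun h0 => h.1 (Subtype.ext h0), fun b hb => ?_⟩
  exact congrArg Subtype.val (h.2 ⟨b, bot_le, hb.le.trans (e.symm {c}).2.2⟩ hb)

variable {x : Fin n ≃ {a : P // IsAtom a}}

/-- In the Boolean lattice `[⊥, y]` an element is determined by the atoms below it. The common upper
bound is essential: different faces of `P` may have the same support. -/
theorem le_of_supp_subset (hP : IsSimplicialPoset P) {y w v : P} (hw : w ≤ y) (hv : v ≤ y)
    (h : supp x w ⊆ supp x v) : w ≤ v := by
  obtain ⟨r, ⟨e⟩⟩ := hP y
  suffices H : (⟨w, bot_le, hw⟩ : Set.Icc (⊥ : P) y) ≤ ⟨v, bot_le, hv⟩ from H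
  rw [← e.le_iff_le]
  intro c hc
  have h1 : e.symm {c} ≤ ⟨w, bot_le, hw⟩ := by
    rw [e.symm_apply_le]
    simpa using hc
  obtain ⟨i, hi⟩ := x.surjective ⟨_, orderIso_symm_singleton e c⟩
  have h2 : i ∈ supp x v := h (mem_supp.2 (by rw [hi]; exact h1))
  have h3 : e.symm {c} ≤ ⟨v, bot_le, hv⟩ := by
    rw [mem_supp, hi] at h2
    exact h2
  rw [e.symm_apply_le] at h3
  simpa using h3

theorem eq_of_supp_eq (hP : IsSimplicialPoset P) {y w v : P} (hw : w ≤ y) (hv : v ≤ y)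
    (h : supp x w = supp x v) : w = v :=
  le_antisymm (le_of_supp_subset hP hw hv h.le) (le_of_supp_subset hP hv hw h.ge)

/-- The witness is the element of the Boolean lattice `[⊥, y]` that corresponds to the set of atoms
labelled by `S`. -/
theorem exists_le_supp_eq (hP : IsSimplicialPoset P) {y : P} {S : Finset (Fin n)}
    (hS : S ⊆ supp x y) : ∃ w ≤ y, supp x w = S := by
  obtain ⟨r, ⟨e⟩⟩ := hP y
  classical
  let T : Finset (Fin r) := {c | ∃ i ∈ S, ∃ h : (x i : P) ≤ y, e ⟨x i, bot_le, h⟩ = {c}}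
  refine ⟨e.symm T, (e.symm T).2.2, ?_⟩
  ext i
  rw [mem_supp]
  by_cases hi : i ∈ supp x y
  · have hiy := mem_supp.1 hi
    obtain ⟨c, hc⟩ := orderIso_atom e (x i).2 hiy
    have h1 : (x i : P) ≤ e.symm T ↔
        (⟨x i, bot_le, hiy⟩ : Set.Icc (⊥ : P) y) ≤ e.symm T := Iff.rfl
    rw [h1, e.le_symm_apply, hc, Finset.singleton_subset_iff,
      Finset.mem_filter]
    constructor
    · rintro ⟨-, j, hj, hjy, hjc⟩
      have h2 := congrArg Subtype.val (e.injective (hjc.trans hc.symm))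
      rwa [← x.injective (Subtype.ext h2)]
    · exact fun h => ⟨Finset.mem_univ _, i, h, hiy, hc⟩
  · exact iff_of_false (fun h => hi (mem_supp.2 (h.trans (e.symm T).2.2)))
      fun h => hi (hS h)

open Classical in
/-- The face of `y` with support `S`, for `S ⊆ supp y`. -/
def restrictFace (x : Fin n ≃ {a : P // IsAtom a}) (y : P) (S : Finset (Fin n)) : P :=
  if h : ∃ w ≤ y, supp x w = S then h.choose else ⊥

theorem restrictFace_le (y : P) (S : Finset (Fin n)) : restrictFace x y S ≤ y := by
  unfold restrictFace
  split_ifs with h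
  · exact h.choose_spec.1
  · exact bot_le

theorem supp_restrictFace (hP : IsSimplicialPoset P) {y : P} {S : Finset (Fin n)}
    (hS : S ⊆ supp x y) : supp x (restrictFace x y S) = S := by
  have h := exists_le_supp_eq hP hS
  unfold restrictFace
  rw [dif_pos h]
  exact h.choose_spec.2

theorem eq_restrictFace (hP : IsSimplicialPoset P) {w y : P} (hw : w ≤ y) {S : Finset (Fin n)}
    (h : supp x w = S) : w = restrictFace x y S :=
  eq_of_supp_eq hP hw (restrictFace_le y S)
    (h.trans (supp_restrictFace hP (h ▸ supp_mono hw)).symm)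

theorem supp_strictMono (hP : IsSimplicialPoset P) : StrictMono (supp x) := fun _ _ h =>
  Finset.ssubset_iff_subset_ne.2
    ⟨supp_mono h.le, fun he => h.ne (eq_of_supp_eq hP h.le le_rfl he)⟩

/-- Height is preserved by a strictly monotone map along which every smaller value lifts to a
smaller element. Both `supp x` and `Finset.card` are such maps. -/
theorem rk_eq_card_supp (hP : IsSimplicialPoset P) (x : Fin n ≃ {a : P // IsAtom a}) (y : P) :
    rk y = (supp x y).card := by
  have h1 : Order.height y = Order.height (supp x y) := by
    refine Order.height_eq_of_strictMono _ (supp_strictMono hP) (fun a b hb => ?_) y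
    obtain ⟨w, hw, hwb⟩ := exists_le_supp_eq hP hb.le
    exact ⟨w, lt_of_le_of_ne hw fun h => hb.ne (by rw [← hwb, h]), hwb⟩
  have h2 : Order.height (supp x y) = Order.height (supp x y).card := by
    refine Order.height_eq_of_strictMono _ Finset.card_strictMono (fun a b hb => ?_) _
    obtain ⟨t, ht, htb⟩ := Finset.exists_subset_card_eq hb.le
    exact ⟨t, Finset.ssubset_iff_subset_ne.2 ⟨ht, fun h => hb.ne (by rw [← htb, h])⟩, htb⟩
  rw [rk, h1, h2, Order.height_nat]
  rfl

/-- If `w` and `v` have an upper bound `z`, their meet is the face of `z` supported on the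
intersection of the supports. -/
theorem isGLB_restrictFace (hP : IsSimplicialPoset P) {w v z : P} (hw : w ≤ z) (hv : v ≤ z) :
    IsGLB {w, v} (restrictFace x z (supp x w ∩ supp x v)) := by
  have hs := supp_restrictFace (x := x) (y := z) (S := supp x w ∩ supp x v) hP
    (Finset.inter_subset_left.trans (supp_mono hw))
  have hle := restrictFace_le (x := x) z (supp x w ∩ supp x v)
  constructor
  · rintro u (rfl | rfl)
    · exact le_of_supp_subset hP hle hw (by rw [hs]; exact Finset.inter_subset_left)
    · exact le_of_supp_subset hP hle hv (by rw [hs]; exact Finset.inter_subset_right)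
  · intro u hu
    have h1 : u ≤ w := hu (by simp)
    have h2 : u ≤ v := hu (by simp)
    refine le_of_supp_subset (x := x) hP (h1.trans hw) hle ?_
    rw [hs]
    exact Finset.subset_inter (supp_mono h1) (supp_mono h2)

theorem supp_isGLB (hP : IsSimplicialPoset P) {w v z m : P} (hw : w ≤ z) (hv : v ≤ z)
    (hm : IsGLB {w, v} m) : supp x m = supp x w ∩ supp x v := by
  rw [hm.unique (isGLB_restrictFace (x := x) hP hw hv), supp_restrictFace hP]
  exact Finset.inter_subset_left.trans (supp_mono hw)

variable [Fintype P]

/-- Below any upper bound, the face supported on the union of the two supports is already an upper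
bound, so minimality fixes the support. -/
theorem mem_minUpper_iff (hP : IsSimplicialPoset P) (x : Fin n ≃ {a : P // IsAtom a}) {w v z : P} :
    z ∈ minUpper w v ↔ w ≤ z ∧ v ≤ z ∧ supp x z = supp x w ∪ supp x v := by
  simp only [minUpper, Finset.mem_filter, Finset.mem_univ, true_and]
  have hsub : ∀ {u : P}, w ≤ u → v ≤ u → supp x w ∪ supp x v ⊆ supp x u := fun h1 h2 =>
    Finset.union_subset (supp_mono h1) (supp_mono h2)
  constructor
  · rintro ⟨⟨hw, hv⟩, hmin⟩
    refine ⟨hw, hv, ?_⟩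
    have hs := supp_restrictFace hP (hsub hw hv)
    have hle := restrictFace_le (x := x) z (supp x w ∪ supp x v)
    have := hmin ⟨le_of_supp_subset (x := x) hP hw hle (by rw [hs]; exact Finset.subset_union_left),
      le_of_supp_subset (x := x) hP hv hle (by rw [hs]; exact Finset.subset_union_right)⟩ hle
    rwa [le_antisymm hle this] at hs
  · rintro ⟨hw, hv, hs⟩
    refine ⟨⟨hw, hv⟩, fun u hu huz => ?_⟩
    exact le_of_supp_subset hP le_rfl huz (hs.trans_subset (hsub hu.1 hu.2))

theorem exists_mem_minUpper (hP : IsSimplicialPoset P) {x : Fin n ≃ {a : P // IsAtom a}} {w v y : P}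
    (hw : w ≤ y) (hv : v ≤ y) : ∃ z ∈ minUpper w v, z ≤ y := by
  have hs := supp_restrictFace (x := x) (y := y) (S := supp x w ∪ supp x v) hP
    (Finset.union_subset (supp_mono hw) (supp_mono hv))
  have hle := restrictFace_le (x := x) y (supp x w ∪ supp x v)
  refine ⟨_, (mem_minUpper_iff hP x).2 ⟨le_of_supp_subset (x := x) hP hw hle ?_,
    le_of_supp_subset (x := x) hP hv hle ?_, hs⟩, hle⟩
  · rw [hs]
    exact Finset.subset_union_left
  · rw [hs]
    exact Finset.subset_union_right

/-- The pair `(z, j)` determines `y`. Sums over faces covering `y` can thus be rewritten as sums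
over facets of `z`. -/
theorem mem_minUpper_atom_iff (hP : IsSimplicialPoset P) {j : Fin n} {y z : P}
    (hj : j ∉ supp x y) :
    z ∈ minUpper (x j : P) y ↔ j ∈ supp x z ∧ y = restrictFace x z ((supp x z).erase j) := by
  rw [mem_minUpper_iff hP x, supp_atom]
  constructor
  · rintro ⟨h1, h2, h3⟩
    refine ⟨mem_supp.2 h1, eq_restrictFace hP h2 ?_⟩
    rw [h3, ← Finset.insert_eq, Finset.erase_insert hj]
  · rintro ⟨h1, h2⟩
    refine ⟨mem_supp.1 h1, h2 ▸ restrictFace_le _ _, ?_⟩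
    have : supp x y = (supp x z).erase j := by
      rw [h2]
      exact supp_restrictFace hP (Finset.erase_subset _ _)
    rw [this, ← Finset.insert_eq, Finset.insert_erase h1]

end Combinatorics

/-! ### Orientation signs and the coboundary in coordinates -/

section Coboundary

variable {k : Type*} [Field k] {P : Type*} [PartialOrder P] [OrderBot P] {n : ℕ}
  {x : Fin n ≃ {a : P // IsAtom a}} (O : VertexOrientation x)

open Classical in
/-- The sign exponent of the coboundary: the number of vertices in `S` after `j`. -/
def orientCount (S : Finset (Fin n)) (j : Fin n) : ℕ := {i ∈ S | O.ord.lt j i}.card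

/-- The sign comparing an orientation with the numerical order on the set `S` of vertices. -/
def orientSign (k : Type*) [Field k] (S : Finset (Fin n)) : k :=
  (-1) ^ ∑ i ∈ S, orientCount O {l ∈ S | i < l} i

theorem orientSign_mul_self (S : Finset (Fin n)) :
    orientSign O k S * orientSign O k S = 1 := by
  rw [orientSign, ← mul_pow]
  simp

/-- `orientSign` counts the pairs on which the orientation and the numerical order agree. Erasing
`j` loses the agreeing pairs that involve `j`; together with the vertices after `j` in the
orientation these number, modulo 2, the `i < j`. -/
theorem orientSign_erase {z : P} {j : Fin n} (hj : j ∈ supp x z) :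
    orientSign O k (supp x z) * (-1) ^ orientCount O ((supp x z).erase j) j =
      (-1) ^ {i ∈ supp x z | i < j}.card * orientSign O k ((supp x z).erase j) := by
  classical
  set S := supp x z with hS
  set T := S.erase j with hT
  have hST : S = insert j T := (Finset.insert_erase hj).symm
  have hjT : j ∉ T := by simp [T]
  have h1 : ∑ i ∈ S, orientCount O {l ∈ S | i < l} i =
      orientCount O {l ∈ T | j < l} j + ((∑ i ∈ T, orientCount O {l ∈ T | i < l} i) +
        {i ∈ T | i < j ∧ O.ord.lt i j}.card) := by
    have e1 : {l ∈ S | j < l} = {l ∈ T | j < l} := by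
      rw [hST, Finset.filter_insert, if_neg (lt_irrefl j)]
    rw [hST, Finset.sum_insert hjT, ← hST, e1, Finset.card_filter, ← Finset.sum_add_distrib]
    congr 1
    refine Finset.sum_congr rfl fun i hi => ?_
    have hij : i ≠ j := fun h => hjT (h ▸ hi)
    rw [hST, Finset.filter_insert]
    unfold orientCount
    split_ifs with h2 h3 h3
    · rw [Finset.filter_insert, if_pos h3.2, Finset.card_insert_of_notMem (by simp [hjT])]
    · rw [Finset.filter_insert, if_neg fun h => h3 ⟨h2, h⟩, add_zero]
    · exact absurd h3.1 h2
    · rfl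
  have h2 : {i ∈ S | i < j}.card = {i ∈ T | i < j ∧ O.ord.lt i j}.card +
      {i ∈ T | i < j ∧ O.ord.lt j i}.card := by
    rw [hST, Finset.filter_insert, if_neg (lt_irrefl j), ← Finset.card_union_of_disjoint]
    · congr 1
      ext i
      simp only [Finset.mem_filter, Finset.mem_union]
      constructor
      · rintro ⟨hi, hij⟩
        have hiS : i ∈ S := Finset.mem_of_mem_erase hi
        -- Comparability of `i` and `j` in the orientation is why the set has to be the support of a
        -- face.
        rcases O.total z i hiS j hj with h | h
        · exact Or.inl ⟨hi, hij, (@lt_of_le_of_ne _ O.ord i j h hij.ne)⟩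
        · exact Or.inr ⟨hi, hij, (@lt_of_le_of_ne _ O.ord j i h hij.ne')⟩
      · rintro (h | h)
        · exact ⟨h.1, h.2.1⟩
        · exact ⟨h.1, h.2.1⟩
    · rw [Finset.disjoint_left]
      intro i h h'
      simp only [Finset.mem_filter] at h h'
      exact (@lt_asymm _ O.ord.toPreorder i j h.2.2 h'.2.2)
  have h3 : orientCount O T j = orientCount O {l ∈ T | j < l} j +
      {i ∈ T | i < j ∧ O.ord.lt j i}.card := by
    unfold orientCount
    rw [← Finset.card_union_of_disjoint]
    · congr 1
      ext i
      simp only [Finset.mem_filter, Finset.mem_union]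
      constructor
      · rintro ⟨hi, hij⟩
        have hne : i ≠ j := fun h => hjT (h ▸ hi)
        rcases lt_or_gt_of_ne hne with h | h
        · exact Or.inr ⟨hi, h, hij⟩
        · exact Or.inl ⟨⟨hi, h⟩, hij⟩
      · rintro (h | h)
        · exact ⟨h.1.1, h.2⟩
        · exact ⟨h.1, h.2.2⟩
    · rw [Finset.disjoint_left]
      intro i h h'
      simp only [Finset.mem_filter] at h h'
      exact lt_asymm h.1.2 h'.2.1
  rw [orientSign, orientSign, h1, h2, h3]
  have h4 : ((-1 : k) ^ orientCount O {l ∈ T | j < l} j) ^ 2 = 1 := by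
    rw [← pow_mul, mul_comm, pow_mul]
    simp
  simp only [pow_add]
  -- The vertices after `j` in both orders are counted twice, so their sign squares to `1`.
  linear_combination ((-1 : k) ^ (∑ i ∈ T, orientCount O {l ∈ T | i < l} i)) *
    (-1 : k) ^ {i ∈ T | i < j ∧ O.ord.lt i j}.card *
    (-1 : k) ^ {i ∈ T | i < j ∧ O.ord.lt j i}.card * h4

/-- The value at `z` is a signed sum over the facets of `z`, the same shape as the Čech
differential, which sums over `G.erase j`. -/
theorem coboundary_apply [Fintype P] (hP : IsSimplicialPoset P) (f : P → k) (z : P) :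
    coboundary k O f z = ∑ j ∈ supp x z, (-1) ^ orientCount O ((supp x z).erase j) j *
      f (restrictFace x z ((supp x z).erase j)) := by
  classical
  simp only [coboundary, Fintype.linearCombination_apply, Finset.sum_apply, Pi.smul_apply,
    smul_eq_mul, Finset.mul_sum, Pi.single_apply, Finset.sum_ite_eq]
  have h1 : ∀ y : P, ∑ j ∈ (supp x y)ᶜ, f y * ((-1 : k) ^ orientCount O (supp x y) j *
      if z ∈ minUpper (x j : P) y then 1 else 0) =
      ∑ j, if j ∈ supp x z ∧ y = restrictFace x z ((supp x z).erase j) then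
        (-1 : k) ^ orientCount O ((supp x z).erase j) j * f y else 0 := by
    intro y
    rw [← Finset.sum_subset (Finset.subset_univ (supp x y)ᶜ)]
    · refine Finset.sum_congr rfl fun j hj => ?_
      have hj' : j ∉ supp x y := by simpa using hj
      simp only [mem_minUpper_atom_iff hP hj']
      split_ifs with h
      · have : supp x y = (supp x z).erase j := by
          rw [h.2]
          exact supp_restrictFace hP (Finset.erase_subset _ _)
        rw [this]
        ring
      · ring
    · intro j _ hj
      rw [if_neg]
      rintro ⟨h, rfl⟩
      rw [Finset.mem_compl, not_not, supp_restrictFace hP (Finset.erase_subset _ _)] at hj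
      simp at hj
  refine (Finset.sum_congr rfl fun y _ => h1 y).trans ?_
  rw [Finset.sum_comm, ← Finset.sum_subset (Finset.subset_univ (supp x z))]
  · refine Finset.sum_congr rfl fun j hj => ?_
    simp [hj]
  · intro j _ hj
    simp [hj]

end Coboundary

open MvPolynomial

theorem faceDegree_apply {P : Type*} [PartialOrder P] [OrderBot P] {n : ℕ}
    {x : Fin n ≃ {a : P // IsAtom a}} (y : P) (i : Fin n) :
    faceDegree x y i = if i ∈ supp x y then 1 else 0 := by
  simp only [faceDegree]

/-! ### Straightening: standard monomials span the face ring -/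

section FaceRingStructure

variable (k : Type*) [Field k] {P : Type*} [PartialOrder P] [OrderBot P] [Fintype P] {n : ℕ}
  (x : Fin n ≃ {a : P // IsAtom a})

/-- The class of a face in the face ring. -/
def faceVar (y : P) : FaceRing k x := FaceRing.mk k x (X y)

/-- The exponent vector of the squarefree monomial supported on `S`. -/
def indexVec (S : Finset (Fin n)) : Fin n →₀ ℕ := ∑ i ∈ S, Finsupp.single i 1

variable {k x}

theorem indexVec_apply (S : Finset (Fin n)) (i : Fin n) :
    indexVec S i = if i ∈ S then 1 else 0 := by
  simp [indexVec, Finsupp.finsetSum_apply, Finsupp.single_apply]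

theorem support_indexVec (S : Finset (Fin n)) : (indexVec S).support = S := by
  ext i
  simp [indexVec_apply]

theorem monomial_one_eq_prod (δ : Fin n →₀ ℕ) :
    (monomial δ 1 : MvPolynomial (Fin n) k) = ∏ i, X i ^ δ i := by
  rw [monomial_eq, Finsupp.prod_fintype _ _ (fun i => pow_zero _), map_one, one_mul]

theorem algebraMap_apply_eq (p : MvPolynomial (Fin n) k) :
    algebraMap (MvPolynomial (Fin n) k) (FaceRing k x) p = FaceRing.structureMap k x p := rfl

theorem algebraMap_X (j : Fin n) :
    algebraMap (MvPolynomial (Fin n) k) (FaceRing k x) (X j) = faceVar k x (x j : P) := by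
  rw [algebraMap_apply_eq, FaceRing.structureMap, aeval_X, faceVar]

theorem mk_eq_zero {p : MvPolynomial P k} (h : p ∈ faceIdeal k P) : FaceRing.mk k x p = 0 :=
  Ideal.Quotient.eq_zero_iff_mem.2 h

theorem faceVar_bot : faceVar k x (⊥ : P) = 1 := by
  have h : FaceRing.mk k x (X ⊥ - 1) = 0 :=
    mk_eq_zero (Ideal.subset_span (Or.inr rfl))
  rw [map_sub, map_one, sub_eq_zero] at h
  exact h

theorem faceVar_mul_eq_zero {w v : P} (h : minUpper w v = ∅) :
    faceVar k x w * faceVar k x v = 0 := by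
  rw [faceVar, faceVar, ← map_mul]
  exact mk_eq_zero (Ideal.subset_span (Or.inl (Or.inl ⟨w, v, h, rfl⟩)))

theorem faceVar_mul {w v m : P} (h : (minUpper w v).Nonempty) (hm : IsGLB {w, v} m) :
    faceVar k x w * faceVar k x v = ∑ z ∈ minUpper w v, faceVar k x m * faceVar k x z := by
  have h' : FaceRing.mk k x (X w * X v - X m * ∑ z ∈ minUpper w v, X z) = 0 :=
    mk_eq_zero (Ideal.subset_span (Or.inl (Or.inr ⟨w, v, m, h, hm, rfl⟩)))
  rw [map_sub, map_mul, map_mul, map_sum, sub_eq_zero] at h'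
  simp only [faceVar, ← Finset.mul_sum]
  exact h'

/-- Each face with support `insert j S` covers exactly one face with support `S`, so it occurs
exactly once in the double sum. -/
theorem sum_minUpper_atom (hP : IsSimplicialPoset P) {M : Type*} [AddCommMonoid M]
    {S : Finset (Fin n)} {j : Fin n} (hj : j ∉ S) (F : P → P → M) :
    ∑ y with supp x y = S, ∑ z ∈ minUpper (x j : P) y, F y z =
      ∑ z with supp x z = insert j S, F (restrictFace x z S) z := by
  rw [Finset.sum_comm' (t' := {z | supp x z = insert j S}) (s' := fun z => {restrictFace x z S})]
  · simp
  · intro y z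
    simp only [Finset.mem_filter, Finset.mem_univ, true_and, Finset.mem_singleton]
    constructor
    · rintro ⟨h1, h2⟩
      rw [mem_minUpper_iff hP x] at h2
      exact ⟨eq_restrictFace hP h2.2.1 h1, by rw [h2.2.2, supp_atom, h1]; rfl⟩
    · rintro ⟨h1, h2⟩
      have h3 : supp x y = S := by
        rw [h1]
        exact supp_restrictFace hP (by rw [h2]; exact Finset.subset_insert _ _)
      refine ⟨h3, ?_⟩
      rw [mem_minUpper_atom_iff hP (by rwa [h3]), h2, Finset.erase_insert hj]
      exact ⟨Finset.mem_insert_self _ _, h1⟩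

/-- The meet of `x_j` and `y` is `⊥`, which is `1` in the ring. -/
theorem faceVar_atom_mul {j : Fin n} {y : P} (hj : j ∉ supp x y) :
    faceVar k x (x j : P) * faceVar k x y = ∑ z ∈ minUpper (x j : P) y, faceVar k x z := by
  rcases (minUpper (x j : P) y).eq_empty_or_nonempty with h | h
  · rw [h, faceVar_mul_eq_zero h, Finset.sum_empty]
  · have hm : IsGLB {(x j : P), y} ⊥ := by
      refine ⟨fun _ _ => bot_le, fun u hu => ?_⟩
      have h1 : u ≤ x j := hu (by simp)
      have h2 : u ≤ y := hu (by simp)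
      rcases (x j).2.le_iff.1 h1 with h | h
      · exact h.le
      · exact absurd (mem_supp.2 (h ▸ h2)) hj
    simp [faceVar_mul h hm, faceVar_bot]

theorem algebraMap_indexVec (hP : IsSimplicialPoset P) (S : Finset (Fin n)) :
    algebraMap (MvPolynomial (Fin n) k) (FaceRing k x) (monomial (indexVec S) 1) =
      ∑ y with supp x y = S, faceVar k x y := by
  classical
  rw [indexVec, monomial_sum_one]
  induction S using Finset.induction_on with
  | empty =>
    have : ({y : P | supp x y = ∅} : Finset P) = {⊥} := by
      ext y
      simp only [Finset.mem_filter, Finset.mem_univ, true_and, Finset.mem_singleton]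
      refine ⟨fun h => ?_, fun h => h ▸ supp_bot x⟩
      exact eq_of_supp_eq hP le_rfl bot_le (h.trans (supp_bot x).symm)
    rw [this, Finset.sum_singleton, faceVar_bot, Finset.prod_empty, map_one]
  | insert j S hj ih =>
    rw [Finset.prod_insert hj, map_mul, ih]
    have : (monomial (Finsupp.single j 1) 1 : MvPolynomial (Fin n) k) = X j := rfl
    rw [this, algebraMap_X, Finset.mul_sum,
      ← sum_minUpper_atom hP hj (fun _ z => faceVar k x z)]
    refine Finset.sum_congr rfl fun y hy => faceVar_atom_mul ?_
    rw [Finset.mem_filter] at hy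
    rwa [hy.2]

/-- Expand `x^{supp m}` as the sum of all faces with the support of `m`. A face in this sum having a
common upper bound with `z` has one with `m` too, hence equals `m`; all other terms kill `z`. -/
theorem faceVar_mul_of_le (hP : IsSimplicialPoset P) {m z : P} (h : m ≤ z) :
    faceVar k x m * faceVar k x z =
      (monomial (indexVec (supp x m)) 1 : MvPolynomial (Fin n) k) • faceVar k x z := by
  rw [Algebra.smul_def, algebraMap_indexVec hP, Finset.sum_mul, Finset.sum_eq_single m]
  · intro y hy hym
    rw [Finset.mem_filter] at hy
    refine faceVar_mul_eq_zero (Finset.eq_empty_of_forall_notMem fun u hu => hym ?_)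
    rw [mem_minUpper_iff hP x] at hu
    exact eq_of_supp_eq hP hu.1 (h.trans hu.2.1) hy.2
  · simp

variable (k x) in
/-- The span of the standard basis elements `x^δ w`, `supp δ ⊆ supp w`, of degree `γ`. -/
def standardSpan (γ : Fin n → ℤ) : Submodule k (FaceRing k x) :=
  Submodule.span k {b | ∃ (w : P) (δ : Fin n →₀ ℕ), δ.support ⊆ supp x w ∧
    (∀ i, faceDegree x w i + δ i = γ i) ∧
    b = (monomial δ 1 : MvPolynomial (Fin n) k) • faceVar k x w}

/-- Straightening: the relation replaces `v w` by a sum of products `m u` with `m ≤ u`, and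
`faceVar_mul_of_le` trades `m` for a monomial supported on `u`. -/
theorem faceVar_mul_mem_standardSpan (hP : IsSimplicialPoset P) (v : P) {γ : Fin n → ℤ}
    {b : FaceRing k x} (hb : b ∈ standardSpan k x γ) :
    faceVar k x v * b ∈ standardSpan k x (faceDegree x v + γ) := by
  induction hb using Submodule.span_induction with
  | zero => rw [mul_zero]; exact Submodule.zero_mem _
  | add a b _ _ ha hb => rw [mul_add]; exact Submodule.add_mem _ ha hb
  | smul r b _ hb => rw [mul_smul_comm]; exact Submodule.smul_mem _ _ hb
  | mem b hb =>
    obtain ⟨w, δ, hδ, hdeg, rfl⟩ := hb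
    rw [mul_smul_comm]
    rcases (minUpper v w).eq_empty_or_nonempty with h | h
    · rw [faceVar_mul_eq_zero h, smul_zero]
      exact Submodule.zero_mem _
    · obtain ⟨z, hz⟩ := id h
      have hz' := (mem_minUpper_iff hP x).1 hz
      have hm := isGLB_restrictFace (x := x) hP hz'.1 hz'.2.1
      have hsm := supp_isGLB (x := x) hP hz'.1 hz'.2.1 hm
      set m := restrictFace x z (supp x v ∩ supp x w)
      rw [faceVar_mul h hm, Finset.smul_sum]
      refine Submodule.sum_mem _ fun u hu => ?_
      have hu' := (mem_minUpper_iff hP x).1 hu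
      rw [faceVar_mul_of_le hP ((hm.1 (by simp : v ∈ ({v, w} : Set P))).trans hu'.1), smul_smul,
        monomial_mul, one_mul]
      refine Submodule.subset_span ⟨u, _, ?_, fun i => ?_, rfl⟩
      · refine Finsupp.support_add.trans (Finset.union_subset ?_ ?_)
        · exact hδ.trans (supp_mono hu'.2.1)
        · rw [support_indexVec, hsm]
          exact Finset.inter_subset_left.trans (supp_mono hu'.1)
      · rw [Pi.add_apply, ← hdeg i]
        simp only [faceDegree_apply, hu'.2.2, Finsupp.add_apply, indexVec_apply, hsm,
          Finset.mem_union, Finset.mem_inter]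
        -- Degrees match because the indicators of union and intersection add up to those of the two
        -- supports.
        by_cases h1 : i ∈ supp x v <;> by_cases h2 : i ∈ supp x w <;> simp [h1, h2] <;> ring

theorem one_mem_standardSpan : (1 : FaceRing k x) ∈ standardSpan k x 0 := by
  refine Submodule.subset_span ⟨⊥, 0, by simp, fun i => ?_, ?_⟩
  · simp [faceDegree_apply, supp_bot]
  · rw [faceVar_bot]
    exact (one_smul _ _).symm

theorem mk_monomial_mem_standardSpan (hP : IsSimplicialPoset P) (d : P →₀ ℕ) :
    FaceRing.mk k x (monomial d 1) ∈ standardSpan k x (Finsupp.weight (faceDegree x) d) := by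
  induction d using Finsupp.induction with
  | zero =>
    rw [map_zero]
    have : FaceRing.mk k x (monomial 0 1) = 1 := map_one _
    rw [this]
    exact one_mem_standardSpan
  | single_add v e d _ _ ih =>
    rw [monomial_single_add, map_add, Finsupp.weight_single]
    clear * - ih hP
    induction e with
    | zero => simpa using ih
    | succ e he =>
      rw [pow_succ', mul_assoc, map_mul, succ_nsmul', add_assoc]
      exact faceVar_mul_mem_standardSpan hP v he

theorem grading_le_standardSpan (hP : IsSimplicialPoset P) (γ : Fin n → ℤ) :
    FaceRing.grading k x γ ≤ standardSpan k x γ := by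
  rintro _ ⟨p, hp, rfl⟩
  rw [SetLike.mem_coe, mem_weightedHomogeneousSubmodule] at hp
  rw [AlgHom.toLinearMap_apply, p.as_sum, map_sum]
  refine Submodule.sum_mem _ fun d hd => ?_
  have h1 : Finsupp.weight (faceDegree x) d = γ := hp (mem_support_iff.1 hd)
  have h2 : (monomial d (coeff d p) : MvPolynomial P k) = coeff d p • monomial d 1 := by
    rw [smul_monomial, smul_eq_mul, mul_one]
  rw [h2, map_smul, ← h1]
  exact Submodule.smul_mem _ _ (mk_monomial_mem_standardSpan hP d)

theorem faceVar_mem_grading (y : P) : faceVar k x y ∈ FaceRing.grading k x (faceDegree x y) :=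
  ⟨X y, isWeightedHomogeneous_X _ _ _, rfl⟩

theorem monomial_smul_mem_grading (δ : Fin n →₀ ℕ) {γ : Fin n → ℤ} {b : FaceRing k x}
    (hb : b ∈ FaceRing.grading k x γ) :
    (monomial δ 1 : MvPolynomial (Fin n) k) • b ∈
      FaceRing.grading k x (fun i => γ i + δ i) := by
  obtain ⟨p, hp, rfl⟩ := hb
  have h : IsWeightedHomogeneous (faceDegree x) (∏ i, (X (x i : P) : MvPolynomial P k) ^ δ i)
      (∑ i, δ i • faceDegree x (x i : P)) :=
    IsWeightedHomogeneous.prod _ _ _ fun i _ => (isWeightedHomogeneous_X k _ _).pow _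
  refine ⟨(∏ i, X (x i : P) ^ δ i) * p, ?_, ?_⟩
  · have h2 := h.mul hp
    have h3 : (∑ i, δ i • faceDegree x (x i : P)) + γ = fun i => γ i + δ i := by
      ext i
      simp [faceDegree_apply, supp_atom, add_comm]
    rw [h3] at h2
    exact h2
  · rw [AlgHom.toLinearMap_apply, AlgHom.toLinearMap_apply, map_mul, Algebra.smul_def,
      monomial_one_eq_prod, map_prod, map_prod]
    simp only [map_pow, algebraMap_X, faceVar]

theorem mem_standardSpan_top (hP : IsSimplicialPoset P) (b : FaceRing k x) :
    b ∈ Submodule.span k {b | ∃ (w : P) (δ : Fin n →₀ ℕ), δ.support ⊆ supp x w ∧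
      b = (monomial δ 1 : MvPolynomial (Fin n) k) • faceVar k x w} := by
  obtain ⟨p, rfl⟩ : ∃ p, FaceRing.mk k x p = b := Ideal.Quotient.mk_surjective b
  rw [p.as_sum, map_sum]
  refine Submodule.sum_mem _ fun d _ => ?_
  have h2 : (monomial d (coeff d p) : MvPolynomial P k) = coeff d p • monomial d 1 := by
    rw [smul_monomial, smul_eq_mul, mul_one]
  rw [h2, map_smul]
  refine Submodule.smul_mem _ _ (Submodule.span_mono ?_ (mk_monomial_mem_standardSpan hP d))
  rintro _ ⟨w, δ, h, -, rfl⟩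
  exact ⟨w, δ, h, rfl⟩

end FaceRingStructure

/-! ### Evaluation at a face and independence of standard monomials -/

section FaceLaurent

variable (k : Type*) [Field k] {P : Type*} [PartialOrder P] [OrderBot P] {n : ℕ}
  (x : Fin n ≃ {a : P // IsAtom a})

/-- The Laurent polynomial ring on which `x_j` acts as a variable for `j ∈ supp y` and as zero for
other `j`. -/
def FaceLaurent (_x : Fin n ≃ {a : P // IsAtom a}) (_y : P) : Type _ :=
  AddMonoidAlgebra k (Fin n → ℤ)

variable (y : P)

instance : CommRing (FaceLaurent k x y) :=
  inferInstanceAs (CommRing (AddMonoidAlgebra k (Fin n → ℤ)))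

instance : Algebra k (FaceLaurent k x y) :=
  inferInstanceAs (Algebra k (AddMonoidAlgebra k (Fin n → ℤ)))

/-- The Laurent monomial with exponent `a`. -/
def FaceLaurent.single (a : Fin n → ℤ) : FaceLaurent k x y :=
  AddMonoidAlgebra.single a (1 : k)

/-- The coefficient of a Laurent polynomial at the exponent `a`. -/
def FaceLaurent.coeff (a : Fin n → ℤ) : FaceLaurent k x y →ₗ[k] k :=
  (Finsupp.lapply a) ∘ₗ (AddMonoidAlgebra.coeffLinearEquiv k).toLinearMap

variable {k x y}

theorem FaceLaurent.single_zero : FaceLaurent.single k x y 0 = 1 := rfl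

theorem FaceLaurent.single_mul_single (a b : Fin n → ℤ) :
    FaceLaurent.single k x y a * FaceLaurent.single k x y b = FaceLaurent.single k x y (a + b) :=
  (AddMonoidAlgebra.single_mul_single _ _ _ _).trans (by rw [one_mul]; rfl)

theorem FaceLaurent.isUnit_single (a : Fin n → ℤ) : IsUnit (FaceLaurent.single k x y a) :=
  IsUnit.of_mul_eq_one (FaceLaurent.single k x y (-a)) (by
    rw [FaceLaurent.single_mul_single, add_neg_cancel, FaceLaurent.single_zero])

theorem FaceLaurent.coeff_single (a b : Fin n → ℤ) :
    FaceLaurent.coeff k x y a (FaceLaurent.single k x y b) = if b = a then 1 else 0 := by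
  classical
  exact (Finsupp.single_apply (M := k)).trans (by congr)

theorem FaceLaurent.coeff_single_mul (a b : Fin n → ℤ) (f : FaceLaurent k x y) :
    FaceLaurent.coeff k x y (b + a) (FaceLaurent.single k x y b * f) =
      FaceLaurent.coeff k x y a f := by
  refine (AddMonoidAlgebra.coeff_single_mul_apply (R := k) f 1 b (b + a)).trans ?_
  rw [one_mul, neg_add_cancel_left]
  rfl

theorem FaceLaurent.ext {f g : FaceLaurent k x y}
    (h : ∀ a, FaceLaurent.coeff k x y a f = FaceLaurent.coeff k x y a g) : f = g :=
  AddMonoidAlgebra.ext (Finsupp.ext h)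

theorem FaceLaurent.single_pow (a : Fin n → ℤ) (r : ℕ) :
    FaceLaurent.single k x y a ^ r = FaceLaurent.single k x y (r • a) := by
  induction r with
  | zero => rw [pow_zero, zero_nsmul, FaceLaurent.single_zero]
  | succ r ih => rw [pow_succ, ih, FaceLaurent.single_mul_single, succ_nsmul]

theorem faceDegree_atom (j : Fin n) : faceDegree x (x j : P) = Pi.single j 1 := by
  ext i
  simp [faceDegree_apply, supp_atom, Pi.single_apply]

variable [Fintype P]

open Classical in
variable (k x y) in
/-- The value of the face `w` in the Laurent polynomial ring of `y`. -/
def evalFaceAux (w : P) : FaceLaurent k x y :=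
  if w ≤ y then FaceLaurent.single k x y (faceDegree x w) else 0

/-- If `w` and `v` both lie below `y`, exactly one of their minimal upper bounds does, and the
relation becomes an identity of exponents. Otherwise none does, and both sides evaluate to zero. -/
theorem faceIdeal_le_ker (hP : IsSimplicialPoset P) (y : P) (p : MvPolynomial P k)
    (hp : p ∈ faceIdeal k P) : aeval (evalFaceAux k x y) p = 0 := by
  classical
  suffices faceIdeal k P ≤ RingHom.ker (aeval (evalFaceAux k x y)).toRingHom from this hp
  refine Ideal.span_le.2 ?_
  rintro p ((⟨w, v, h, rfl⟩ | ⟨w, v, m, h, hm, rfl⟩) | rfl)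
  · simp only [SetLike.mem_coe, RingHom.mem_ker, AlgHom.toRingHom_eq_coe, RingHom.coe_coe,
      map_mul, aeval_X, evalFaceAux]
    split_ifs with h1 h2
    · obtain ⟨z, hz, -⟩ := exists_mem_minUpper (x := x) hP h1 h2
      simp [h] at hz
    all_goals simp
  · simp only [SetLike.mem_coe, RingHom.mem_ker, AlgHom.toRingHom_eq_coe, RingHom.coe_coe,
      map_mul, aeval_X, map_sub, map_sum]
    by_cases h1 : w ≤ y ∧ v ≤ y
    · obtain ⟨h1, h2⟩ := h1
      obtain ⟨z, hz, hzy⟩ := exists_mem_minUpper (x := x) hP h1 h2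
      have hz' := (mem_minUpper_iff hP x).1 hz
      rw [Finset.sum_eq_single z]
      · have hmy : m ≤ y := (hm.1 (by simp : w ∈ ({w, v} : Set P))).trans h1
        simp only [evalFaceAux, if_pos h1, if_pos h2, if_pos hzy, if_pos hmy,
          FaceLaurent.single_mul_single]
        rw [sub_eq_zero]
        congr 1
        ext i
        simp only [Pi.add_apply, faceDegree_apply, hz'.2.2,
          supp_isGLB (x := x) hP hz'.1 hz'.2.1 hm, Finset.mem_union, Finset.mem_inter]
        by_cases h3 : i ∈ supp x w <;> by_cases h4 : i ∈ supp x v <;> simp [h3, h4]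
      · intro u hu huz
        have hu' := (mem_minUpper_iff hP x).1 hu
        rw [evalFaceAux, if_neg]
        exact fun huy => huz (eq_of_supp_eq hP huy hzy (hu'.2.2.trans hz'.2.2.symm))
      · exact fun h => absurd hz h
    · have h2 : evalFaceAux k x y w * evalFaceAux k x y v = 0 := by
        simp only [evalFaceAux]
        split_ifs with h2 h3
        · exact absurd ⟨h2, h3⟩ h1
        all_goals simp
      rw [h2, Finset.sum_eq_zero, mul_zero, sub_zero]
      intro z hz
      have hz' := (mem_minUpper_iff hP x).1 hz
      rw [evalFaceAux, if_neg]
      exact fun hzy => h1 ⟨hz'.1.trans hzy, hz'.2.1.trans hzy⟩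
  · have : faceDegree x (⊥ : P) = 0 := by
      ext i
      simp [faceDegree_apply, supp_bot]
    simp [evalFaceAux, this, FaceLaurent.single_zero]

/-- The evaluation of the face ring in the Laurent polynomial ring of a face `y`. -/
def evalFace (hP : IsSimplicialPoset P) (x : Fin n ≃ {a : P // IsAtom a}) (y : P) :
    FaceRing k x →ₐ[k] FaceLaurent k x y :=
  Ideal.Quotient.liftₐ (faceIdeal k P) (aeval (evalFaceAux k x y)) (faceIdeal_le_ker hP y)

theorem evalFace_faceVar (hP : IsSimplicialPoset P) (y w : P) :
    evalFace hP x y (faceVar k x w) = evalFaceAux k x y w :=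
  aeval_X (evalFaceAux k x y) w

theorem evalFace_algebraMap_monomial (hP : IsSimplicialPoset P) {y : P} {δ : Fin n →₀ ℕ}
    (hδ : δ.support ⊆ supp x y) :
    evalFace hP x y (algebraMap (MvPolynomial (Fin n) k) (FaceRing k x) (monomial δ 1)) =
      FaceLaurent.single k x y (fun i => δ i) := by
  have key : ∀ T : Finset (Fin n), evalFace hP x y (algebraMap (MvPolynomial (Fin n) k)
      (FaceRing k x) (∏ i ∈ T, X i ^ δ i)) =
      FaceLaurent.single k x y (∑ i ∈ T, δ i • Pi.single i 1) := by
    classical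
    intro T
    induction T using Finset.induction_on with
    | empty => rw [Finset.prod_empty, map_one, map_one, Finset.sum_empty, FaceLaurent.single_zero]
    | insert j T hj ih =>
      rw [Finset.prod_insert hj, map_mul, map_mul, ih, Finset.sum_insert hj,
        ← FaceLaurent.single_mul_single, map_pow, map_pow, algebraMap_X, evalFace_faceVar]
      congr 1
      by_cases hjy : j ∈ supp x y
      · rw [evalFaceAux, if_pos (mem_supp.1 hjy), faceDegree_atom, FaceLaurent.single_pow]
      · have : δ j = 0 := by
          by_contra h
          exact hjy (hδ (Finsupp.mem_support_iff.2 h))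
        rw [this, pow_zero, zero_nsmul, FaceLaurent.single_zero]
  rw [monomial_one_eq_prod, key]
  congr 1
  ext i
  simp [Pi.single_apply]

open Classical in
theorem evalFace_standard (hP : IsSimplicialPoset P) (y : P) {w : P} {δ : Fin n →₀ ℕ}
    (hδ : δ.support ⊆ supp x w) :
    evalFace hP x y ((monomial δ 1 : MvPolynomial (Fin n) k) • faceVar k x w) =
      if w ≤ y then FaceLaurent.single k x y (fun i => δ i + faceDegree x w i) else 0 := by
  rw [Algebra.smul_def, map_mul, evalFace_faceVar, evalFaceAux]
  split_ifs with h
  · rw [evalFace_algebraMap_monomial hP (hδ.trans (supp_mono h)), FaceLaurent.single_mul_single]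
    rfl
  · rw [mul_zero]

/-- The coefficient of `x^δ w` in a combination of standard monomials is recovered by evaluating at
`w` and reading the exponent `δ + deg w`; no other standard monomial contributes there. -/
theorem evalFace_jointly_injective (hP : IsSimplicialPoset P) {b : FaceRing k x}
    (h : ∀ y, evalFace hP x y b = 0) : b = 0 := by
  classical
  let I := {p : P × (Fin n →₀ ℕ) // p.2.support ⊆ supp x p.1}
  let B : I → FaceRing k x := fun p =>
    (monomial p.1.2 1 : MvPolynomial (Fin n) k) • faceVar k x p.1.1
  have hb : b ∈ Submodule.span k (Set.range B) := by
    refine Submodule.span_mono ?_ (mem_standardSpan_top hP b)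
    rintro _ ⟨w, δ, hδ, rfl⟩
    exact ⟨⟨(w, δ), hδ⟩, rfl⟩
  obtain ⟨c, rfl⟩ := Finsupp.mem_span_range_iff_exists_finsupp.1 hb
  suffices c = 0 by rw [this, Finsupp.sum_zero_index]
  ext ⟨⟨w, δ⟩, hδ⟩
  have h1 := congrArg (FaceLaurent.coeff k x w (fun i => δ i + faceDegree x w i)) (h w)
  rw [Finsupp.sum, map_sum, map_sum, map_zero, Finset.sum_eq_single ⟨(w, δ), hδ⟩] at h1
  · rw [map_smul, map_smul, evalFace_standard hP w hδ, if_pos le_rfl, FaceLaurent.coeff_single,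
      if_pos rfl, smul_eq_mul, mul_one] at h1
    exact h1
  · rintro ⟨⟨v, ε⟩, hε⟩ - hne
    rw [map_smul, map_smul, evalFace_standard hP w hε]
    split_ifs with hvw
    · rw [FaceLaurent.coeff_single, if_neg, smul_zero]
      -- The exponent of a standard monomial has the support of its face, so equal exponents below
      -- `w` force `v = w` and then `ε = δ`.
      intro heq
      apply hne
      have hs : supp x v = supp x w := by
        refine (supp_mono hvw).antisymm fun i hi => ?_
        by_contra hiv
        have h2 := congrFun heq i
        have h3 : ε i = 0 := by
          by_contra h
          exact hiv (hε (Finsupp.mem_support_iff.2 h))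
        simp only [faceDegree_apply, hi, hiv, h3] at h2
        simp at h2
        omega
      have hvw' := eq_of_supp_eq hP hvw le_rfl hs
      subst hvw'
      congr
      ext i
      have h2 := congrFun heq i
      simpa using h2
    · rw [map_zero, smul_zero]
  · intro h
    simp only [Finsupp.mem_support_iff, not_not] at h
    rw [h, zero_smul, map_zero, map_zero]

end FaceLaurent

/-! ### Which coefficients an evaluation can have -/

section Evaluation

variable {k : Type*} [Field k] {P : Type*} [PartialOrder P] [OrderBot P] {n : ℕ}
  {x : Fin n ≃ {a : P // IsAtom a}}

instance (y : P) : Algebra (MvPolynomial (Fin n) k) (FaceLaurent k x y) :=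
  (aeval fun j => evalFaceAux k x y (x j : P)).toRingHom.toAlgebra

instance (y : P) : IsScalarTower k (MvPolynomial (Fin n) k) (FaceLaurent k x y) :=
  IsScalarTower.of_algebraMap_eq fun r =>
    ((aeval fun j => evalFaceAux k x y (x j : P)).commutes r).symm

variable [Fintype P]

theorem evalFace_algebraMap (hP : IsSimplicialPoset P) (y : P) (p : MvPolynomial (Fin n) k) :
    evalFace hP x y (algebraMap _ _ p) = algebraMap _ (FaceLaurent k x y) p := by
  have h : (evalFace hP x y).comp (FaceRing.structureMap k x) =
      aeval fun j => evalFaceAux k x y (x j : P) := by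
    refine algHom_ext fun j => ?_
    rw [AlgHom.comp_apply, aeval_X, ← algebraMap_apply_eq, algebraMap_X, evalFace_faceVar]
  exact DFunLike.congr_fun h p

theorem algebraMap_faceLaurent_monomial (hP : IsSimplicialPoset P) {y : P} {δ : Fin n →₀ ℕ}
    (hδ : δ.support ⊆ supp x y) :
    algebraMap (MvPolynomial (Fin n) k) (FaceLaurent k x y) (monomial δ 1) =
      FaceLaurent.single k x y (fun i => δ i) := by
  rw [← evalFace_algebraMap hP, evalFace_algebraMap_monomial hP hδ]

/-- The evaluation of the face ring at a face, as a map of modules over `k[x_1, …, x_n]`. -/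
def evalFaceLinear (hP : IsSimplicialPoset P) (x : Fin n ≃ {a : P // IsAtom a}) (y : P) :
    FaceRing k x →ₗ[MvPolynomial (Fin n) k] FaceLaurent k x y where
  toFun := evalFace hP x y
  map_add' := map_add _
  map_smul' p b := by
    rw [Algebra.smul_def, map_mul, evalFace_algebraMap, RingHom.id_apply, Algebra.smul_def]

theorem coeff_evalFace_of_neg (hP : IsSimplicialPoset P) (y : P) (b : FaceRing k x)
    {a : Fin n → ℤ} {j : Fin n} (hj : a j < 0) :
    FaceLaurent.coeff k x y a (evalFace hP x y b) = 0 := by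
  classical
  induction mem_standardSpan_top hP b using Submodule.span_induction with
  | zero => rw [map_zero, map_zero]
  | add b c _ _ hb hc => rw [map_add, map_add, hb, hc, add_zero]
  | smul r b _ hb => rw [map_smul, map_smul, hb, smul_zero]
  | mem b hb =>
    obtain ⟨w, δ, hδ, rfl⟩ := hb
    rw [evalFace_standard hP y hδ]
    split_ifs with h
    · rw [FaceLaurent.coeff_single, if_neg]
      rintro rfl
      simp only [faceDegree_apply] at hj
      split_ifs at hj <;> omega
    · rw [map_zero]

theorem coeff_evalFace_of_notMem_supp (hP : IsSimplicialPoset P) (y : P) (b : FaceRing k x)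
    {a : Fin n → ℤ} {j : Fin n} (hj : a j ≠ 0) (hjy : j ∉ supp x y) :
    FaceLaurent.coeff k x y a (evalFace hP x y b) = 0 := by
  classical
  induction mem_standardSpan_top hP b using Submodule.span_induction with
  | zero => rw [map_zero, map_zero]
  | add b c _ _ hb hc => rw [map_add, map_add, hb, hc, add_zero]
  | smul r b _ hb => rw [map_smul, map_smul, hb, smul_zero]
  | mem b hb =>
    obtain ⟨w, δ, hδ, rfl⟩ := hb
    rw [evalFace_standard hP y hδ]
    split_ifs with h
    · rw [FaceLaurent.coeff_single, if_neg]
      rintro rfl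
      have h1 : j ∉ supp x w := fun h' => hjy (supp_mono h h')
      have h2 : δ j = 0 := Finsupp.notMem_support_iff.1 fun h' => h1 (hδ h')
      simp [faceDegree_apply, h1, h2] at hj
    · rw [map_zero]

/-- An exponent supported on `supp y` only sees standard monomials whose face has support inside
`supp y`, and such faces below `z` already lie below `y`. -/
theorem coeff_evalFace_of_le (hP : IsSimplicialPoset P) {y z : P} (hyz : y ≤ z)
    (b : FaceRing k x) {a : Fin n → ℤ} (ha : ∀ j ∉ supp x y, a j = 0) :
    FaceLaurent.coeff k x z a (evalFace hP x z b) =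
      FaceLaurent.coeff k x y a (evalFace hP x y b) := by
  classical
  induction mem_standardSpan_top hP b using Submodule.span_induction with
  | zero => simp only [map_zero]
  | add b c _ _ hb hc => simp only [map_add, hb, hc]
  | smul r b _ hb => simp only [map_smul, hb]
  | mem b hb =>
    obtain ⟨w, δ, hδ, rfl⟩ := hb
    rw [evalFace_standard hP y hδ, evalFace_standard hP z hδ]
    by_cases hwz : w ≤ z
    · by_cases hwy : w ≤ y
      · rw [if_pos hwz, if_pos hwy, FaceLaurent.coeff_single, FaceLaurent.coeff_single]
      · rw [if_pos hwz, if_neg hwy, map_zero, FaceLaurent.coeff_single, if_neg]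
        rintro rfl
        refine hwy (le_of_supp_subset (x := x) hP hwz hyz fun i hi => ?_)
        by_contra hiy
        have := ha i hiy
        simp only [faceDegree_apply, hi, if_true] at this
        omega
    · rw [if_neg hwz, if_neg fun h => hwz (h.trans hyz), map_zero, map_zero]

theorem coeff_evalFace_of_mem_grading (hP : IsSimplicialPoset P) (y : P) {b : FaceRing k x}
    {a γ : Fin n → ℤ} (hb : b ∈ FaceRing.grading k x γ) (ha : a ≠ γ) :
    FaceLaurent.coeff k x y a (evalFace hP x y b) = 0 := by
  classical
  replace hb := grading_le_standardSpan hP γ hb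
  induction hb using Submodule.span_induction with
  | zero => rw [map_zero, map_zero]
  | add b c _ _ hb hc => rw [map_add, map_add, hb, hc, add_zero]
  | smul r b _ hb => rw [map_smul, map_smul, hb, smul_zero]
  | mem b hb =>
    obtain ⟨w, δ, hδ, hdeg, rfl⟩ := hb
    rw [evalFace_standard hP y hδ]
    split_ifs with h
    · rw [FaceLaurent.coeff_single, if_neg]
      rintro rfl
      exact ha (funext fun i => by rw [← hdeg i, add_comm])
    · rw [map_zero]

end Evaluation

/-! ### Localizations with monomial denominators -/

section VarSubmonoid

variable {k : Type*} [Field k] {n : ℕ} {F : Finset (Fin n)}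

theorem monomial_mem_varSubmonoid {β : Fin n →₀ ℕ} (hβ : β.support ⊆ F) :
    (monomial β 1 : MvPolynomial (Fin n) k) ∈ varSubmonoid k F := by
  rw [monomial_one_eq_prod]
  refine Submonoid.prod_mem (varSubmonoid k F) fun i _ => ?_
  by_cases hi : i ∈ F
  · exact Submonoid.pow_mem _ (Submonoid.subset_closure (Set.mem_image_of_mem _ hi)) _
  · rw [Finsupp.notMem_support_iff.1 fun h => hi (hβ h), pow_zero]
    exact Submonoid.one_mem _

theorem exists_monomial_of_mem_varSubmonoid {s : MvPolynomial (Fin n) k}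
    (hs : s ∈ varSubmonoid k F) : ∃ β : Fin n →₀ ℕ, β.support ⊆ F ∧ s = monomial β 1 := by
  classical
  induction hs using Submonoid.closure_induction with
  | mem s hs =>
    obtain ⟨i, hi, rfl⟩ := hs
    refine ⟨Finsupp.single i 1, ?_, rfl⟩
    exact Finsupp.support_single_subset.trans (Finset.singleton_subset_iff.2 hi)
  | one => exact ⟨0, by simp, rfl⟩
  | mul s t _ _ hs ht =>
    obtain ⟨β, hβ, rfl⟩ := hs
    obtain ⟨β', hβ', rfl⟩ := ht
    refine ⟨β + β', Finsupp.support_add.trans (Finset.union_subset hβ hβ'), ?_⟩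
    rw [monomial_mul, one_mul]

variable {M : Type*} [AddCommGroup M] [Module (MvPolynomial (Fin n) k) M]

theorem exists_monomial_smul_eq (u : CechTerm k n M F) :
    ∃ β : Fin n →₀ ℕ, β.support ⊆ F ∧ ∃ m : M, (monomial β 1 : MvPolynomial (Fin n) k) • u =
      LocalizedModule.mkLinearMap (varSubmonoid k F) M m := by
  obtain ⟨⟨m, s⟩, h⟩ := IsLocalizedModule.surj (varSubmonoid k F)
    (LocalizedModule.mkLinearMap (varSubmonoid k F) M) u
  obtain ⟨β, hβ, hs⟩ := exists_monomial_of_mem_varSubmonoid s.2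
  refine ⟨β, hβ, m, ?_⟩
  rw [← hs]
  exact h

theorem monomial_smul_cancel {β : Fin n →₀ ℕ} (hβ : β.support ⊆ F) {u v : CechTerm k n M F}
    (h : (monomial β 1 : MvPolynomial (Fin n) k) • u = (monomial β 1 : MvPolynomial _ k) • v) :
    u = v :=
  IsLocalizedModule.smul_injective (LocalizedModule.mkLinearMap (varSubmonoid k F) M)
    ⟨_, monomial_mem_varSubmonoid hβ⟩ h

/-- The fraction `m / x^β`. -/
def monomialFrac (F : Finset (Fin n)) {β : Fin n →₀ ℕ} (hβ : β.support ⊆ F) (m : M) :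
    CechTerm k n M F :=
  LocalizedModule.mk m ⟨monomial β 1, monomial_mem_varSubmonoid hβ⟩

theorem monomial_smul_monomialFrac {β : Fin n →₀ ℕ} (hβ : β.support ⊆ F) (m : M) :
    (monomial β 1 : MvPolynomial (Fin n) k) • (monomialFrac F hβ m : CechTerm k n M F) =
      LocalizedModule.mkLinearMap (varSubmonoid k F) M m := by
  rw [monomialFrac, LocalizedModule.smul'_mk, LocalizedModule.mkLinearMap_apply]
  exact LocalizedModule.mk_cancel (⟨_, monomial_mem_varSubmonoid hβ⟩ : varSubmonoid k F) m

end VarSubmonoid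

/-! ### Evaluation of the localized face ring -/

section CechEval

variable {k : Type*} [Field k] {P : Type*} [PartialOrder P] [OrderBot P] [Fintype P] {n : ℕ}
  {x : Fin n ≃ {a : P // IsAtom a}} (hP : IsSimplicialPoset P) {F : Finset (Fin n)} {y : P}

-- Monomials supported on `supp y` evaluate to Laurent monomials, which are units; this lets
-- evaluation extend to the localization.
include hP in
theorem isUnit_algebraMap_end (hF : F ⊆ supp x y) (s : varSubmonoid k F) :
    IsUnit (algebraMap (MvPolynomial (Fin n) k)
      (Module.End (MvPolynomial (Fin n) k) (FaceLaurent k x y)) s) := by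
  obtain ⟨β, hβ, hs⟩ := exists_monomial_of_mem_varSubmonoid s.2
  have hu : IsUnit (algebraMap (MvPolynomial (Fin n) k) (FaceLaurent k x y) s) := by
    rw [hs, algebraMap_faceLaurent_monomial hP (hβ.trans hF)]
    exact FaceLaurent.isUnit_single _
  obtain ⟨t, ht⟩ := hu.exists_right_inv
  rw [Module.End.isUnit_iff]
  constructor
  · intro a b hab
    simp only [Module.algebraMap_end_apply, Algebra.smul_def] at hab
    exact hu.mul_left_cancel hab
  · intro b
    refine ⟨t * b, ?_⟩
    rw [Module.algebraMap_end_apply, Algebra.smul_def, ← mul_assoc, ht, one_mul]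

/-- The evaluation of a localization of the face ring at a face `y`. -/
def cechEval (hF : F ⊆ supp x y) :
    CechTerm k n (FaceRing k x) F →ₗ[MvPolynomial (Fin n) k] FaceLaurent k x y :=
  LocalizedModule.lift (varSubmonoid k F) (evalFaceLinear hP x y) (isUnit_algebraMap_end hP hF)

theorem cechEval_mkLinearMap (hF : F ⊆ supp x y) (m : FaceRing k x) :
    cechEval hP hF (LocalizedModule.mkLinearMap (varSubmonoid k F) _ m) = evalFace hP x y m := by
  rw [cechEval, LocalizedModule.mkLinearMap_apply]
  exact DFunLike.congr_fun (LocalizedModule.lift_comp (varSubmonoid k F) (evalFaceLinear hP x y)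
    (isUnit_algebraMap_end hP hF)) m

theorem cechEval_liftOfLE {G : Finset (Fin n)} (hFG : F ⊆ G) (hG : G ⊆ supp x y)
    (u : CechTerm k n (FaceRing k x) F) :
    cechEval hP hG (LocalizedModule.liftOfLE (varSubmonoid k F) (varSubmonoid k G)
      (varSubmonoid_mono k hFG) u) = cechEval hP (hFG.trans hG) u := by
  have h : cechEval hP hG ∘ₗ LocalizedModule.liftOfLE (varSubmonoid k F) (varSubmonoid k G)
      (varSubmonoid_mono k hFG) = cechEval hP (hFG.trans hG) := by
    refine IsLocalizedModule.ext (varSubmonoid k F)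
      (LocalizedModule.mkLinearMap (varSubmonoid k F) (FaceRing k x))
      (isUnit_algebraMap_end hP (hFG.trans hG)) ?_
    ext m
    simp only [LinearMap.comp_apply]
    rw [cechEval_mkLinearMap, IsLocalizedModule.liftOfLE_apply, cechEval_mkLinearMap]
  exact DFunLike.congr_fun h u

theorem coeff_cechEval (hF : F ⊆ supp x y) {u : CechTerm k n (FaceRing k x) F}
    {β : Fin n →₀ ℕ} (hβ : β.support ⊆ F) {m : FaceRing k x}
    (h : (monomial β 1 : MvPolynomial (Fin n) k) • u =
      LocalizedModule.mkLinearMap (varSubmonoid k F) _ m) (a : Fin n → ℤ) :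
    FaceLaurent.coeff k x y a (cechEval hP hF u) =
      FaceLaurent.coeff k x y (fun i => β i + a i) (evalFace hP x y m) := by
  rw [← cechEval_mkLinearMap hP hF, ← h, map_smul, Algebra.smul_def,
    algebraMap_faceLaurent_monomial hP (hβ.trans hF)]
  exact (FaceLaurent.coeff_single_mul a _ _).symm

/-- Faces with `F ⊄ supp y` are not tested, but there `x_F` evaluates to zero. So `x_F` times a
numerator of `u` vanishes under every evaluation, and `x_F` is invertible in the localization. -/
theorem cechEval_jointly_injective {u : CechTerm k n (FaceRing k x) F}
    (h : ∀ (y : P) (hF : F ⊆ supp x y), cechEval hP hF u = 0) : u = 0 := by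
  obtain ⟨β, hβ, m, hm⟩ := exists_monomial_smul_eq u
  have key : (monomial (indexVec F) 1 : MvPolynomial (Fin n) k) • m = 0 := by
    refine evalFace_jointly_injective hP fun y => ?_
    rw [Algebra.smul_def, map_mul]
    by_cases hF : F ⊆ supp x y
    · rw [← cechEval_mkLinearMap hP hF, ← cechEval_mkLinearMap hP hF, ← hm, map_smul, h y hF,
        smul_zero, mul_zero]
    · obtain ⟨j, hj, hjy⟩ := Finset.not_subset.1 hF
      rw [indexVec, monomial_sum_one, ← Finset.mul_prod_erase _ _ hj, map_mul, map_mul]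
      have : (monomial (Finsupp.single j 1) 1 : MvPolynomial (Fin n) k) = X j := rfl
      rw [this, algebraMap_X, evalFace_faceVar, evalFaceAux, if_neg fun h => hjy (mem_supp.2 h),
        zero_mul, zero_mul]
  refine monomial_smul_cancel (k := k) hβ (monomial_smul_cancel (k := k)
    (support_indexVec F).subset ?_)
  rw [hm, ← map_smul, key, map_zero, smul_zero, smul_zero]

/-- Denominators involve only variables in `F`, so no negative exponent can arise outside `F`. -/
theorem coeff_cechEval_of_neg (hF : F ⊆ supp x y) (u : CechTerm k n (FaceRing k x) F)
    {a : Fin n → ℤ} {j : Fin n} (hj : a j < 0) (hjF : j ∉ F) :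
    FaceLaurent.coeff k x y a (cechEval hP hF u) = 0 := by
  obtain ⟨β, hβ, m, hm⟩ := exists_monomial_smul_eq u
  rw [coeff_cechEval hP hF hβ hm]
  refine coeff_evalFace_of_neg hP y m (j := j) ?_
  have : β j = 0 := Finsupp.notMem_support_iff.1 fun h => hjF (hβ h)
  simpa [this] using hj

theorem coeff_cechEval_of_notMem_supp (hF : F ⊆ supp x y) (u : CechTerm k n (FaceRing k x) F)
    {a : Fin n → ℤ} {j : Fin n} (hj : a j ≠ 0) (hjy : j ∉ supp x y) :
    FaceLaurent.coeff k x y a (cechEval hP hF u) = 0 := by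
  obtain ⟨β, hβ, m, hm⟩ := exists_monomial_smul_eq u
  rw [coeff_cechEval hP hF hβ hm]
  refine coeff_evalFace_of_notMem_supp hP y m (j := j) ?_ hjy
  have : β j = 0 := Finsupp.notMem_support_iff.1 fun h => hjy (hF (hβ h))
  simpa [this] using hj

theorem coeff_cechEval_of_le {z : P} (hF : F ⊆ supp x y) (hyz : y ≤ z)
    (u : CechTerm k n (FaceRing k x) F) {a : Fin n → ℤ} (ha : ∀ j ∉ supp x y, a j = 0) :
    FaceLaurent.coeff k x z a (cechEval hP (hF.trans (supp_mono hyz)) u) =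
      FaceLaurent.coeff k x y a (cechEval hP hF u) := by
  obtain ⟨β, hβ, m, hm⟩ := exists_monomial_smul_eq u
  rw [coeff_cechEval hP hF hβ hm, coeff_cechEval hP _ hβ hm]
  refine coeff_evalFace_of_le hP hyz m fun j hj => ?_
  have : β j = 0 := Finsupp.notMem_support_iff.1 fun h => hj (hF (hβ h))
  simp [this, ha j hj]

theorem coeff_cechEval_of_mem_grading (hF : F ⊆ supp x y) {u : CechTerm k n (FaceRing k x) F}
    {a α : Fin n → ℤ} (hu : u ∈ cechTermGrading k (FaceRing.grading k x) F α) (ha : a ≠ α) :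
    FaceLaurent.coeff k x y a (cechEval hP hF u) = 0 := by
  induction hu using Submodule.span_induction with
  | zero => rw [map_zero, map_zero]
  | add b c _ _ hb hc => rw [map_add, map_add, hb, hc, add_zero]
  | smul r b _ hb => rw [LinearMap.map_smul_of_tower, map_smul, hb, smul_zero]
  | mem u hu =>
    obtain ⟨β, hβ, m, hm, hum⟩ := hu
    rw [coeff_cechEval hP hF hβ hum]
    refine coeff_evalFace_of_mem_grading hP y hm fun h => ha (funext fun i => ?_)
    have : (β i : ℤ) + a i = α i + β i := congrFun h i
    omega

end CechEval

/-! ### The Čech differential and the grading -/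

section CechDifferential

variable {k : Type*} [Field k] {n : ℕ} {M : Type*} [AddCommGroup M]
  [Module (MvPolynomial (Fin n) k) M]

variable (k M) in
/-- The localization map `M_{x_F} → M_{x_G}` for `F ⊆ G`. -/
abbrev cechRes {F G : Finset (Fin n)} (h : F ⊆ G) :
    CechTerm k n M F →ₗ[MvPolynomial (Fin n) k] CechTerm k n M G :=
  LocalizedModule.liftOfLE (varSubmonoid k F) (varSubmonoid k G) (varSubmonoid_mono k h)

theorem monomial_smul_cechRes_monomialFrac {F G : Finset (Fin n)} (h : F ⊆ G) {β : Fin n →₀ ℕ}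
    (hβ : β.support ⊆ F) (m : M) :
    (monomial β 1 : MvPolynomial (Fin n) k) • cechRes k M h (monomialFrac F hβ m) =
      LocalizedModule.mkLinearMap (varSubmonoid k G) M m := by
  rw [← map_smul, monomial_smul_monomialFrac, IsLocalizedModule.liftOfLE_apply]

variable [Module k M] [IsScalarTower k (MvPolynomial (Fin n) k) M]

theorem cechDifferential_apply (c : CechTotal k n M) (G : Finset (Fin n)) :
    cechDifferential k n M c G = ∑ j ∈ G, (-1 : k) ^ {i ∈ G | i < j}.card •
      cechRes k M (Finset.erase_subset j G) (c (G.erase j)) := by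
  rw [cechDifferential, LinearMap.pi_apply, LinearMap.sum_apply]
  refine Finset.sum_congr rfl fun j _ => ?_
  rw [LinearMap.smul_apply, LinearMap.comp_apply, LinearMap.proj_apply]
  rcases Nat.even_or_odd {i ∈ G | i < j}.card with h | h <;> simp [h.neg_one_pow]

theorem cechRes_mem_grading {𝓜 : (Fin n → ℤ) → Submodule k M} {F G : Finset (Fin n)} (h : F ⊆ G)
    {α : Fin n → ℤ} {u : CechTerm k n M F} (hu : u ∈ cechTermGrading k 𝓜 F α) :
    cechRes k M h u ∈ cechTermGrading k 𝓜 G α := by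
  induction hu using Submodule.span_induction with
  | zero => rw [map_zero]; exact Submodule.zero_mem _
  | add b c _ _ hb hc => rw [map_add]; exact Submodule.add_mem _ hb hc
  | smul r b _ hb => rw [LinearMap.map_smul_of_tower]; exact Submodule.smul_mem _ _ hb
  | mem u hu =>
    obtain ⟨β, hβ, m, hm, hum⟩ := hu
    refine Submodule.subset_span ⟨β, hβ.trans h, m, hm, ?_⟩
    rw [← map_smul, hum, IsLocalizedModule.liftOfLE_apply]

theorem cechDifferential_mem_grading {𝓜 : (Fin n → ℤ) → Submodule k M} {α : Fin n → ℤ}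
    {c : CechTotal k n M} (hc : ∀ F, c F ∈ cechTermGrading k 𝓜 F α) (G : Finset (Fin n)) :
    cechDifferential k n M c G ∈ cechTermGrading k 𝓜 G α := by
  rw [cechDifferential_apply]
  exact Submodule.sum_mem _ fun j _ => Submodule.smul_mem _ _ (cechRes_mem_grading _ (hc _))

end CechDifferential

/-! ### Fractions of nonpositive degree given by faces -/

section FaceFrac

variable {k : Type*} [Field k] {P : Type*} [PartialOrder P] [OrderBot P] [Fintype P] {n : ℕ}
  {x : Fin n ≃ {a : P // IsAtom a}}

/-- The exponent `e_F - α`, restricted to `F`. -/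
def fracExp (F : Finset (Fin n)) (α : Fin n → ℤ) : Fin n →₀ ℕ :=
  Finsupp.onFinset F (fun i => if i ∈ F then (1 - α i).toNat else 0) fun i hi => by
    by_contra h
    simp [h] at hi

theorem support_fracExp (F : Finset (Fin n)) (α : Fin n → ℤ) : (fracExp F α).support ⊆ F :=
  Finsupp.support_onFinset_subset

theorem fracExp_apply (F : Finset (Fin n)) (α : Fin n → ℤ) (i : Fin n) :
    fracExp F α i = if i ∈ F then (1 - α i).toNat else 0 := rfl

theorem mem_degSupp {α : Fin n → ℤ} {i : Fin n} : i ∈ degSupp α ↔ α i ≠ 0 := by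
  simp [degSupp]

/-- For `α ≤ 0` the truncation to `ℕ` changes nothing, and `α` has no part outside `F`. Hence
`faceFrac` has degree exactly `α` when the face has support `F`. -/
theorem fracExp_add {F : Finset (Fin n)} {α : Fin n → ℤ} (hα : α ≤ 0) (hF : degSupp α ⊆ F)
    (i : Fin n) : (fracExp F α i : ℤ) + α i = if i ∈ F then 1 else 0 := by
  have := hα i
  rw [fracExp_apply]
  split_ifs with h
  · rw [Int.toNat_of_nonneg (by simp at this; omega)]
    ring
  · have : α i = 0 := by
      by_contra h'
      exact h (hF (mem_degSupp.2 h'))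
    simp [this]

/-- The element of degree `α` of the localization at `x_F` given by a face `y` with support `F`. -/
def faceFrac (k : Type*) [Field k] (x : Fin n ≃ {a : P // IsAtom a}) (F : Finset (Fin n))
    (α : Fin n → ℤ) (y : P) : CechTerm k n (FaceRing k x) F :=
  monomialFrac F (support_fracExp F α) (faceVar k x y)

theorem monomial_smul_faceFrac (F : Finset (Fin n)) (α : Fin n → ℤ) (y : P) :
    (monomial (fracExp F α) 1 : MvPolynomial (Fin n) k) • faceFrac k x F α y =
      LocalizedModule.mkLinearMap (varSubmonoid k F) _ (faceVar k x y) :=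
  monomial_smul_monomialFrac _ _

theorem faceFrac_mem_grading {α : Fin n → ℤ} (hα : α ≤ 0) {y : P} {F : Finset (Fin n)}
    (hy : supp x y = F) (hF : degSupp α ⊆ F) :
    faceFrac k x F α y ∈ cechTermGrading k (FaceRing.grading k x) F α := by
  refine Submodule.subset_span ⟨_, support_fracExp F α, faceVar k x y, ?_,
    monomial_smul_faceFrac F α y⟩
  have : (fun i => α i + (fracExp F α i : ℤ)) = faceDegree x y := by
    ext i
    rw [add_comm, fracExp_add hα hF, faceDegree_apply, hy]
  rw [this]
  exact faceVar_mem_grading y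

open Classical in
theorem coeff_cechEval_faceFrac (hP : IsSimplicialPoset P) {α : Fin n → ℤ} (hα : α ≤ 0) {y z : P}
    {F : Finset (Fin n)} (hy : supp x y = F) (hF : degSupp α ⊆ F) (hz : F ⊆ supp x z) :
    FaceLaurent.coeff k x z α (cechEval hP hz (faceFrac k x F α y)) = if y ≤ z then 1 else 0 := by
  rw [coeff_cechEval hP hz (support_fracExp F α) (monomial_smul_faceFrac F α y), evalFace_faceVar,
    evalFaceAux]
  split_ifs with h
  · rw [FaceLaurent.coeff_single, if_pos]
    ext i
    rw [fracExp_add hα hF, faceDegree_apply, hy]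
  · rw [map_zero]

/-- Since `α_j = 0`, the denominator for `G` has exactly one extra factor `x_j`. Putting `x_j` into
the numerator as well produces the sum over `M(x_j, y)`, the building block of the coboundary. -/
theorem cechRes_faceFrac {α : Fin n → ℤ} {G : Finset (Fin n)} {j : Fin n} (hj : j ∈ G)
    (hαj : α j = 0) {y : P} (hy : supp x y = G.erase j) :
    cechRes k (FaceRing k x) (Finset.erase_subset j G) (faceFrac k x (G.erase j) α y) =
      ∑ z ∈ minUpper (x j : P) y, faceFrac k x G α z := by
  have hexp : fracExp G α = Finsupp.single j 1 + fracExp (G.erase j) α := by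
    ext i
    rw [Finsupp.add_apply, fracExp_apply, fracExp_apply, Finsupp.single_apply]
    by_cases hij : j = i
    · subst hij
      simp [hj, hαj]
    · simp [hij, Ne.symm hij]
  refine monomial_smul_cancel (k := k) (support_fracExp G α) ?_
  have h1 : (monomial (fracExp G α) 1 : MvPolynomial (Fin n) k) =
      X j * monomial (fracExp (G.erase j) α) 1 := by
    rw [hexp, monomial_single_add, pow_one]
  rw [Finset.smul_sum]
  simp only [monomial_smul_faceFrac]
  rw [h1, mul_smul, faceFrac, monomial_smul_cechRes_monomialFrac, ← map_smul, ← map_sum,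
    Algebra.smul_def, algebraMap_X, faceVar_atom_mul (by simp [hy])]

theorem X_smul_faceFrac {α γ : Fin n → ℤ} {F : Finset (Fin n)} {j : Fin n} (hj : j ∈ F)
    (hγ : γ = α + Pi.single j 1) (hαj : α j < 0) (y : P) :
    (X j : MvPolynomial (Fin n) k) • faceFrac k x F α y = faceFrac k x F γ y := by
  have hexp : fracExp F α = Finsupp.single j 1 + fracExp F γ := by
    ext i
    rw [Finsupp.add_apply, fracExp_apply, fracExp_apply, Finsupp.single_apply, hγ, Pi.add_apply]
    by_cases hij : j = i
    · subst hij
      simp only [hj, if_true, Pi.single_eq_same]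
      omega
    · simp [hij]
  refine monomial_smul_cancel (k := k) (support_fracExp F γ) ?_
  rw [monomial_smul_faceFrac, smul_smul, mul_comm, ← pow_one (X j), ← monomial_single_add, ← hexp,
    monomial_smul_faceFrac]

end FaceFrac

/-! ### Degree `α` Čech cochains as functions on faces -/

section Comparison

variable {k : Type*} [Field k] {P : Type*} [PartialOrder P] [OrderBot P] [Fintype P] {n : ℕ}
  {x : Fin n ≃ {a : P // IsAtom a}} (O : VertexOrientation x)

open Classical in
/-- The map from the simplicial cochains to the Čech cochains of degree `α`. -/
def toCech (k : Type*) [Field k] (α : Fin n → ℤ) : (P → k) →ₗ[k] CechTotal k n (FaceRing k x) :=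
  LinearMap.pi fun F => ∑ y with supp x y = F,
    (LinearMap.proj y : (P → k) →ₗ[k] k).smulRight (orientSign O k F • faceFrac k x F α y)

theorem toCech_apply (α : Fin n → ℤ) (f : P → k) (F : Finset (Fin n)) :
    toCech O k α f F = ∑ y with supp x y = F, (orientSign O k F * f y) • faceFrac k x F α y := by
  classical
  rw [toCech, LinearMap.pi_apply, LinearMap.sum_apply]
  refine (Finset.sum_congr (by congr) fun y _ => ?_)
  rw [LinearMap.smulRight_apply, LinearMap.proj_apply, smul_smul, mul_comm]

theorem cechDifferential_toCech (hP : IsSimplicialPoset P) {α : Fin n → ℤ} {f : P → k}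
    (hf : ∀ y, f y ≠ 0 → degSupp α ⊆ supp x y) :
    cechDifferential k n (FaceRing k x) (toCech O k α f) = toCech O k α (coboundary k O f) := by
  ext G : 1
  rw [cechDifferential_apply, toCech_apply]
  have h1 : ∀ j ∈ G, (-1 : k) ^ {i ∈ G | i < j}.card • cechRes k (FaceRing k x)
      (Finset.erase_subset j G) (toCech O k α f (G.erase j)) =
      ∑ z with supp x z = G, ((-1 : k) ^ {i ∈ G | i < j}.card * orientSign O k (G.erase j) *
        f (restrictFace x z (G.erase j))) • faceFrac k x G α z := by
    intro j hj
    have h2 := sum_minUpper_atom (x := x) hP (Finset.notMem_erase j G)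
      (fun y z => ((-1 : k) ^ {i ∈ G | i < j}.card * orientSign O k (G.erase j) *
        f y) • faceFrac k x G α z)
    rw [Finset.insert_erase hj] at h2
    rw [← h2, toCech_apply, map_sum, Finset.smul_sum]
    refine Finset.sum_congr rfl fun y hy => ?_
    rw [Finset.mem_filter] at hy
    rw [LinearMap.map_smul_of_tower, ← Finset.smul_sum, smul_smul, ← mul_assoc]
    by_cases h0 : f y = 0
    · rw [h0, mul_zero, zero_smul, zero_smul]
    · have hj0 : α j = 0 := by
        by_contra h
        have := hf y h0 (mem_degSupp.2 h)
        simp [hy.2] at this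
      rw [cechRes_faceFrac hj hj0 hy.2]
  rw [Finset.sum_congr rfl h1, Finset.sum_comm]
  refine Finset.sum_congr rfl fun z hz => ?_
  rw [Finset.mem_filter] at hz
  obtain ⟨-, rfl⟩ := hz
  rw [coboundary_apply O hP, Finset.mul_sum, Finset.sum_smul]
  refine Finset.sum_congr rfl fun j hj => ?_
  rw [← orientSign_erase O hj, mul_assoc]

open Classical in
/-- The map from the Čech cochains to the simplicial cochains on the faces above `w`, given by the
coefficients in degree `α`. -/
def ofCech (hP : IsSimplicialPoset P) (α : Fin n → ℤ) (w : P) :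
    CechTotal k n (FaceRing k x) →ₗ[k] (P → k) :=
  LinearMap.pi fun y => if w ≤ y then orientSign O k (supp x y) • FaceLaurent.coeff k x y α ∘ₗ
    (cechEval hP (F := supp x y) subset_rfl).restrictScalars k ∘ₗ LinearMap.proj (supp x y) else 0

open Classical in
theorem ofCech_apply (hP : IsSimplicialPoset P) (α : Fin n → ℤ) (w : P)
    (c : CechTotal k n (FaceRing k x)) {y : P} {F : Finset (Fin n)} (hy : supp x y = F) :
    ofCech O hP α w c y = if w ≤ y then
      orientSign O k F * FaceLaurent.coeff k x y α (cechEval hP hy.ge (c F)) else 0 := by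
  subst hy
  rw [ofCech, LinearMap.pi_apply]
  split_ifs with h
  · rfl
  · rfl

variable {α : Fin n → ℤ} (hα : α ≤ 0) {w : P} (hw : supp x w = degSupp α)
include hα hw

/-- No homogeneity of `c` is needed, since only the coefficient at `α` is read. That coefficient may
be computed at `z` or at a facet of `z` above `w`. -/
theorem ofCech_cechDifferential (hP : IsSimplicialPoset P) (c : CechTotal k n (FaceRing k x)) :
    ofCech O hP α w (cechDifferential k n (FaceRing k x) c) =
      coboundary k O (ofCech O hP α w c) := by
  classical
  ext z
  rw [coboundary_apply O hP, ofCech_apply O hP α w _ rfl]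
  split_ifs with hwz
  · rw [cechDifferential_apply, map_sum, map_sum, Finset.mul_sum]
    refine Finset.sum_congr rfl fun j hj => ?_
    have hs : supp x (restrictFace x z ((supp x z).erase j)) = (supp x z).erase j :=
      supp_restrictFace hP (Finset.erase_subset _ _)
    rw [LinearMap.map_smul_of_tower, map_smul, cechEval_liftOfLE hP (Finset.erase_subset j _), smul_eq_mul,
      ofCech_apply O hP α w c hs]
    split_ifs with hwj
    · rw [← coeff_cechEval_of_le hP hs.ge (restrictFace_le _ _)]
      · have h1 := orientSign_erase (k := k) O hj
        have h2 := orientSign_mul_self (k := k) O ((supp x z).erase j)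
        have h3 := orientSign_mul_self (k := k) O (supp x z)
        -- The relation of `orientSign_erase` with the two powers of `-1` exchanged, as each
        -- `orientSign` is its own inverse.
        have h4 : orientSign O k (supp x z) * (-1) ^ {i ∈ supp x z | i < j}.card =
            (-1) ^ orientCount O ((supp x z).erase j) j * orientSign O k ((supp x z).erase j) := by
          linear_combination (-orientSign O k (supp x z) *
            (-1) ^ {i ∈ supp x z | i < j}.card) * h2 -
            orientSign O k ((supp x z).erase j) * orientSign O k (supp x z) * h1 +
            (-1) ^ orientCount O ((supp x z).erase j) j *
              orientSign O k ((supp x z).erase j) * h3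
        rw [← mul_assoc, ← mul_assoc, h4]
      · intro i hi
        by_contra h
        exact hi (supp_mono hwj (hw ▸ mem_degSupp.2 h))
    -- A facet of `z` that is not above `w` omits a vertex `j` of `w`. Then `α_j < 0` while `x_j` is
    -- not inverted, so the term vanishes on the Čech side too.
    · have hjw : α j < 0 := by
        refine lt_of_le_of_ne (hα j) fun h0 => hwj ?_
        refine le_of_supp_subset (x := x) hP hwz (restrictFace_le _ _) ?_
        rw [hs]
        refine Finset.subset_erase.2 ⟨supp_mono hwz, fun hjw => ?_⟩
        rw [hw] at hjw
        exact mem_degSupp.1 hjw h0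
      rw [coeff_cechEval_of_neg hP _ _ hjw (Finset.notMem_erase j _)]
      simp
  · symm
    refine Finset.sum_eq_zero fun j _ => ?_
    have hs : supp x (restrictFace x z ((supp x z).erase j)) = (supp x z).erase j :=
      supp_restrictFace hP (Finset.erase_subset _ _)
    rw [ofCech_apply O hP α w c hs, if_neg fun h => hwz (h.trans (restrictFace_le _ _)), mul_zero]

-- Evaluating `faceFrac` of `z` at `y` with the same support gives `1` if `z = y` and `0` otherwise.
-- The composite is therefore truncation to the faces above `w`.
open Classical in
theorem ofCech_toCech (hP : IsSimplicialPoset P) (f : P → k) (y : P) :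
    ofCech O hP α w (toCech O k α f) y = if w ≤ y then f y else 0 := by
  rw [ofCech_apply O hP α w _ rfl]
  split_ifs with h
  · have hF : degSupp α ⊆ supp x y := hw ▸ supp_mono h
    rw [toCech_apply, map_sum, map_sum, Finset.sum_eq_single y]
    · rw [LinearMap.map_smul_of_tower, map_smul, coeff_cechEval_faceFrac hP hα rfl hF,
        if_pos le_rfl, smul_eq_mul, mul_one, ← mul_assoc, orientSign_mul_self, one_mul]
    · intro z hz hzy
      rw [Finset.mem_filter] at hz
      rw [LinearMap.map_smul_of_tower, map_smul, coeff_cechEval_faceFrac hP hα hz.2 hF,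
        if_neg fun h => hzy (eq_of_supp_eq hP h le_rfl hz.2), smul_zero]
    · simp
  · rfl

omit hw
-- Both sides have the same coefficients under every evaluation. Below a test face `z` there is only
-- one face with support `F`, and below that only one `w` with the support of `α`, so one term
-- survives in each sum. If `supp α ⊄ F`, both sides are zero.
open Classical in
theorem eq_sum_toCech_ofCech (hP : IsSimplicialPoset P) {c : CechTotal k n (FaceRing k x)}
    (hc : ∀ F, c F ∈ cechTermGrading k (FaceRing.grading k x) F α) :
    c = toCech O k α (∑ w with supp x w = degSupp α, ofCech O hP α w c) := by
  set f : P → k := ∑ w with supp x w = degSupp α, ofCech O hP α w c with hf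
  ext F : 1
  refine sub_eq_zero.1 (cechEval_jointly_injective hP fun z hz => FaceLaurent.ext fun a => ?_)
  rw [map_sub, map_sub, map_zero, sub_eq_zero]
  by_cases hF : degSupp α ⊆ F
  · by_cases ha : a = α
    · subst ha
      have hs : supp x (restrictFace x z F) = F := supp_restrictFace hP hz
      have hle : restrictFace x z F ≤ z := restrictFace_le _ _
      rw [toCech_apply, map_sum, map_sum, Finset.sum_eq_single (restrictFace x z F)]
      · have hs' := supp_restrictFace (x := x) hP (hs ▸ hF)
        rw [LinearMap.map_smul_of_tower, map_smul, coeff_cechEval_faceFrac hP hα hs hF,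
          if_pos hle, hf, Finset.sum_apply,
          Finset.sum_eq_single (restrictFace x (restrictFace x z F) (degSupp a)),
          ofCech_apply O hP _ _ c hs, if_pos (restrictFace_le _ _), ← mul_assoc,
          orientSign_mul_self, one_mul, smul_eq_mul, mul_one]
        · refine coeff_cechEval_of_le hP hs.ge hle _ fun i hi => ?_
          by_contra h
          exact hi (hs.ge (hF (mem_degSupp.2 h)))
        · intro v hv hne
          rw [Finset.mem_filter] at hv
          rw [ofCech_apply O hP _ _ c hs, if_neg fun h => hne (eq_restrictFace hP h hv.2)]
        · intro h
          exact (h (Finset.mem_filter.2 ⟨Finset.mem_univ _, hs'⟩)).elim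
      · intro y hy hne
        rw [Finset.mem_filter] at hy
        rw [LinearMap.map_smul_of_tower, map_smul, coeff_cechEval_faceFrac hP hα hy.2 hF,
          if_neg fun h => hne (eq_restrictFace hP h hy.2), smul_zero]
      · intro h
        exact (h (Finset.mem_filter.2 ⟨Finset.mem_univ _, hs⟩)).elim
    · rw [coeff_cechEval_of_mem_grading hP hz (hc F) ha,
        coeff_cechEval_of_mem_grading hP hz _ ha]
      rw [toCech_apply]
      refine Submodule.sum_mem _ fun y hy => Submodule.smul_mem _ _ ?_
      exact faceFrac_mem_grading hα (Finset.mem_filter.1 hy).2 hF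
  · have h0 : toCech O k α f F = 0 := by
      rw [toCech_apply]
      refine Finset.sum_eq_zero fun y hy => ?_
      rw [Finset.mem_filter] at hy
      rw [hf, Finset.sum_apply, Finset.sum_eq_zero, mul_zero, zero_smul]
      intro v hv
      rw [Finset.mem_filter] at hv
      rw [ofCech_apply O hP _ _ c rfl, if_neg]
      exact fun h => hF (hv.2 ▸ hy.2 ▸ supp_mono h)
    rw [h0, map_zero, map_zero]
    by_cases ha : a = α
    · subst ha
      obtain ⟨j, hj, hjF⟩ := Finset.not_subset.1 hF
      exact coeff_cechEval_of_neg hP hz _ (lt_of_le_of_ne (hα j) (mem_degSupp.1 hj)) hjF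
    · exact coeff_cechEval_of_mem_grading hP hz (hc F) ha

end Comparison

/-! ### The Čech differential squares to zero -/

section CechComplex

variable {k : Type*} [Field k] {n : ℕ}

/-- The sign exponent of the Čech differential. -/
def cechCount (G : Finset (Fin n)) (j : Fin n) : ℕ := {i ∈ G | i < j}.card

theorem cechCount_erase_of_lt {G : Finset (Fin n)} {j l : Fin n} (h : j < l) :
    cechCount (G.erase l) j = cechCount G j := by
  rw [cechCount, cechCount, Finset.filter_erase, Finset.erase_eq_of_notMem]
  simp [h.le]

theorem cechCount_eq_erase_add_one {G : Finset (Fin n)} {j l : Fin n} (h : j < l) (hj : j ∈ G) :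
    cechCount G l = cechCount (G.erase j) l + 1 := by
  rw [cechCount, cechCount, Finset.filter_erase, Finset.card_erase_add_one]
  simp [h, hj]

theorem cech_sign {G : Finset (Fin n)} {j l : Fin n} (hj : j ∈ G) (hl : l ∈ G) (hjl : j ≠ l) :
    (-1 : k) ^ cechCount G j * (-1) ^ cechCount (G.erase j) l +
      (-1) ^ cechCount G l * (-1) ^ cechCount (G.erase l) j = 0 := by
  rcases lt_or_gt_of_ne hjl with h | h
  · rw [cechCount_erase_of_lt h, cechCount_eq_erase_add_one h hj]
    ring
  · rw [cechCount_erase_of_lt h, cechCount_eq_erase_add_one h hl]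
    ring

variable {M : Type*} [AddCommGroup M] [Module (MvPolynomial (Fin n) k) M]

theorem cechRes_cechRes {F G H : Finset (Fin n)} (h : F ⊆ G) (h' : G ⊆ H)
    (u : CechTerm k n M F) : cechRes k M h' (cechRes k M h u) = cechRes k M (h.trans h') u := by
  have : cechRes k M h' ∘ₗ cechRes k M h = cechRes k M (h.trans h') := by
    refine IsLocalizedModule.ext (varSubmonoid k F) (LocalizedModule.mkLinearMap _ M)
      (fun s => IsLocalizedModule.map_units (LocalizedModule.mkLinearMap (varSubmonoid k H) M)
        ⟨s.1, varSubmonoid_mono k (h.trans h') s.2⟩) ?_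
    ext m
    simp only [LinearMap.comp_apply]
    rw [IsLocalizedModule.liftOfLE_apply, IsLocalizedModule.liftOfLE_apply,
      IsLocalizedModule.liftOfLE_apply]
  exact DFunLike.congr_fun this u

variable [Module k M] [IsScalarTower k (MvPolynomial (Fin n) k) M]

/-- Removing `j` and `l` in either order reaches the same component with opposite signs, so swapping
the pair is a cancelling involution. -/
theorem cechDifferential_cechDifferential (c : CechTotal k n M) :
    cechDifferential k n M (cechDifferential k n M c) = 0 := by
  classical
  ext G : 1
  let r : Finset (Fin n) → CechTerm k n M G := fun F =>
    if h : F ⊆ G then cechRes k M h (c F) else 0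
  have h1 : cechDifferential k n M (cechDifferential k n M c) G = ∑ j ∈ G, ∑ l ∈ G.erase j,
      ((-1 : k) ^ cechCount G j * (-1) ^ cechCount (G.erase j) l) • r ((G.erase j).erase l) := by
    rw [cechDifferential_apply]
    refine Finset.sum_congr rfl fun j _ => ?_
    rw [cechDifferential_apply, map_sum, Finset.smul_sum]
    refine Finset.sum_congr rfl fun l _ => ?_
    rw [LinearMap.map_smul_of_tower, cechRes_cechRes, smul_smul]
    simp only [r]
    rw [dif_pos]
    rfl
  rw [h1, Finset.sum_sigma', Pi.zero_apply]
  refine Finset.sum_involution (fun p _ => ⟨p.2, p.1⟩) ?_ ?_ ?_ ?_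
  · rintro ⟨j, l⟩ hp
    simp only [Finset.mem_sigma, Finset.mem_erase] at hp
    rw [Finset.erase_right_comm, ← add_smul, cech_sign hp.1 hp.2.2 hp.2.1.symm, zero_smul]
  · rintro ⟨j, l⟩ hp - h
    simp only [Finset.mem_sigma, Finset.mem_erase] at hp
    simp only [Sigma.mk.injEq] at h
    exact hp.2.1 h.1
  · rintro ⟨j, l⟩ hp
    simp only [Finset.mem_sigma, Finset.mem_erase] at hp ⊢
    exact ⟨hp.2.2, hp.2.1.symm, hp.1⟩
  · rintro ⟨j, l⟩ -
    rfl

end CechComplex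

/-! ### Acyclicity in degrees with a positive coordinate -/

section Vanishing

variable {k : Type*} [Field k] {P : Type*} [PartialOrder P] [OrderBot P] [Fintype P] {n : ℕ}
  {x : Fin n ≃ {a : P // IsAtom a}}

/-- An evaluation at `y` with `j ∈ supp y` factors through inverting `x_j`. If `j ∉ supp y`, no
exponent with `α_j ≠ 0` can occur. -/
theorem eq_zero_of_cechRes_eq_zero (hP : IsSimplicialPoset P) {F G : Finset (Fin n)} (h : F ⊆ G)
    {j : Fin n} (hG : G ⊆ insert j F) {α : Fin n → ℤ} (hj : 0 < α j)
    {u : CechTerm k n (FaceRing k x) F} (hu : u ∈ cechTermGrading k (FaceRing.grading k x) F α)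
    (h0 : cechRes k (FaceRing k x) h u = 0) : u = 0 := by
  refine cechEval_jointly_injective hP fun y hF => FaceLaurent.ext fun a => ?_
  rw [map_zero]
  by_cases ha : a = α
  · subst ha
    by_cases hjy : j ∈ supp x y
    · rw [← cechEval_liftOfLE hP h (hG.trans (Finset.insert_subset hjy hF)), h0, map_zero, map_zero]
    · exact coeff_cechEval_of_notMem_supp hP hF u hj.ne' hjy
  · exact coeff_cechEval_of_mem_grading hP hF hu ha

/-- A standard monomial `x^δ w` of degree `γ` has `δ_j ≥ γ_j - 1 ≥ b`, because the face contributes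
at most `1`. This is why the inequality is strict. -/
theorem exists_monomial_smul_of_mem_grading (hP : IsSimplicialPoset P) {γ : Fin n → ℤ} {j : Fin n}
    {b : ℕ} (hb : (b : ℤ) < γ j) {m : FaceRing k x} (hm : m ∈ FaceRing.grading k x γ) :
    ∃ m' ∈ FaceRing.grading k x (fun i => γ i - (Finsupp.single j b i : ℕ)),
      m = (monomial (Finsupp.single j b) 1 : MvPolynomial (Fin n) k) • m' := by
  classical
  replace hm := grading_le_standardSpan hP γ hm
  induction hm using Submodule.span_induction with
  | zero => exact ⟨0, Submodule.zero_mem _, (smul_zero _).symm⟩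
  | add c d _ _ hc hd =>
    obtain ⟨c', hc', rfl⟩ := hc
    obtain ⟨d', hd', rfl⟩ := hd
    exact ⟨c' + d', Submodule.add_mem _ hc' hd', (smul_add _ _ _).symm⟩
  | smul r c _ hc =>
    obtain ⟨c', hc', rfl⟩ := hc
    exact ⟨r • c', Submodule.smul_mem _ _ hc', smul_comm _ _ _⟩
  | mem c hc =>
    obtain ⟨w, δ, hδ, hdeg, rfl⟩ := hc
    have hle : Finsupp.single j b ≤ δ := by
      rw [Finsupp.single_le_iff]
      have := hdeg j
      rw [faceDegree_apply] at this
      split_ifs at this <;> omega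
    refine ⟨(monomial (δ - Finsupp.single j b) 1 : MvPolynomial (Fin n) k) • faceVar k x w, ?_, ?_⟩
    · have h1 := monomial_smul_mem_grading (k := k) (δ - Finsupp.single j b)
        (faceVar_mem_grading (k := k) (x := x) w)
      convert h1 using 2
      ext i
      have h2 := hle i
      rw [← hdeg i, Finsupp.tsub_apply, Nat.cast_sub h2]
      ring
    · rw [smul_smul, monomial_mul, one_mul, add_tsub_cancel_of_le hle]

/-- With denominator `x^β`, the numerator has `j`-degree `α_j + β_j > β_j`, so the power of `x_j` in
the denominator cancels. -/
theorem exists_cechRes_eq (hP : IsSimplicialPoset P) {F G : Finset (Fin n)} (h : F ⊆ G)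
    {j : Fin n} (hG : G ⊆ insert j F) {α : Fin n → ℤ} (hj : 0 < α j)
    {u : CechTerm k n (FaceRing k x) G} (hu : u ∈ cechTermGrading k (FaceRing.grading k x) G α) :
    ∃ v ∈ cechTermGrading k (FaceRing.grading k x) F α, cechRes k (FaceRing k x) h v = u := by
  classical
  induction hu using Submodule.span_induction with
  | zero => exact ⟨0, Submodule.zero_mem _, map_zero _⟩
  | add c d _ _ hc hd =>
    obtain ⟨c', hc', rfl⟩ := hc
    obtain ⟨d', hd', rfl⟩ := hd
    exact ⟨c' + d', Submodule.add_mem _ hc' hd', map_add _ _ _⟩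
  | smul r c _ hc =>
    obtain ⟨c', hc', rfl⟩ := hc
    exact ⟨r • c', Submodule.smul_mem _ _ hc', LinearMap.map_smul_of_tower _ _ _⟩
  | mem u hu =>
    obtain ⟨β, hβ, m, hm, hum⟩ := hu
    obtain ⟨m', hm', rfl⟩ := exists_monomial_smul_of_mem_grading hP (j := j) (b := β j) (by omega) hm
    have hle : Finsupp.single j (β j) ≤ β := Finsupp.single_le_iff.2 le_rfl
    set β' := β - Finsupp.single j (β j) with hβ'
    have hsum : β = Finsupp.single j (β j) + β' := (add_tsub_cancel_of_le hle).symm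
    have hs : β'.support ⊆ F := by
      intro i hi
      rw [Finsupp.mem_support_iff, hβ', Finsupp.tsub_apply, Finsupp.single_apply] at hi
      have hij : j ≠ i := by
        rintro rfl
        simp at hi
      have hβi : β i ≠ 0 := fun h0 => hi (by rw [h0, Nat.zero_sub])
      have hiG := hβ (Finsupp.mem_support_iff.2 hβi)
      exact Finset.mem_of_mem_insert_of_ne (hG hiG) hij.symm
    refine ⟨monomialFrac F hs m', Submodule.subset_span ⟨β', hs, m', ?_,
      monomial_smul_monomialFrac hs m'⟩, monomial_smul_cancel (k := k) hβ ?_⟩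
    · convert hm' using 2
      ext i
      have h1 := DFunLike.congr_fun hsum i
      rw [Finsupp.add_apply] at h1
      omega
    · have h2 : (monomial β 1 : MvPolynomial (Fin n) k) =
          monomial (Finsupp.single j (β j)) 1 * monomial β' 1 := by
        rw [monomial_mul, one_mul, ← hsum]
      rw [hum, h2, mul_smul, monomial_smul_cechRes_monomialFrac, map_smul]

/-- Inverting `x_j` being bijective in degree `α`, lift the components of `z` on sets containing `j`
to a cochain `c` on sets avoiding `j`. Then `z - dc` is a cocycle vanishing on sets containing `j`;
its differential at `insert j F` has a single term, and injectivity makes its component at `F`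
vanish. -/
theorem exists_cechDifferential_eq (hP : IsSimplicialPoset P) {i : ℤ} {α : Fin n → ℤ} {j : Fin n}
    (hj : 0 < α j) {z : CechTotal k n (FaceRing k x)}
    (hz : z ∈ cechCocycles k n (FaceRing k x) i)
    (hzα : ∀ F, z F ∈ cechTermGrading k (FaceRing.grading k x) F α) :
    ∃ c ∈ cechCochains k n (FaceRing k x) (i - 1), cechDifferential k n (FaceRing k x) c = z := by
  classical
  have hsurj : ∀ F : Finset (Fin n), ∃ v ∈ cechTermGrading k (FaceRing.grading k x) F α,
      cechRes k (FaceRing k x) (Finset.subset_insert j F) v = z (insert j F) := fun F =>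
    exists_cechRes_eq hP _ subset_rfl hj (hzα _)
  choose v hv hvz using hsurj
  -- The sign cancels that of the `j`-term of the differential; vanishing on sets containing `j`
  -- removes the other terms.
  let c : CechTotal k n (FaceRing k x) := fun F =>
    if j ∈ F ∨ (F.card : ℤ) ≠ i - 1 then 0 else
      (-1 : k) ^ {l ∈ insert j F | l < j}.card • v F
  have hcα : ∀ F, c F ∈ cechTermGrading k (FaceRing.grading k x) F α := by
    intro F
    simp only [c]
    split_ifs
    · exact Submodule.zero_mem _
    · exact Submodule.smul_mem _ _ (hv F)
  have hc : c ∈ cechCochains k n (FaceRing k x) (i - 1) := fun F hF => if_pos (Or.inr hF)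
  have hcj : ∀ F, j ∈ F → c F = 0 := fun F hF => if_pos (Or.inl hF)
  have hdc : ∀ G, j ∈ G → cechDifferential k n (FaceRing k x) c G = z G := by
    intro G hG
    rw [cechDifferential_apply, Finset.sum_eq_single_of_mem j hG]
    · by_cases hcard : (G.card : ℤ) = i
      · have h1 : c (G.erase j) = (-1 : k) ^ {l ∈ G | l < j}.card • v (G.erase j) := by
          simp only [c]
          rw [if_neg, Finset.insert_erase hG]
          rw [not_or, not_not, Finset.card_erase_of_mem hG,
            Nat.cast_sub (Finset.card_pos.2 ⟨j, hG⟩), hcard]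
          exact ⟨Finset.notMem_erase j G, by simp⟩
        have h2 : ∀ G', G' = insert j (G.erase j) → ∀ h : G.erase j ⊆ G',
            cechRes k (FaceRing k x) h (v (G.erase j)) = z G' := by
          rintro _ rfl h
          exact hvz _
        rw [h1, LinearMap.map_smul_of_tower, smul_smul, ← mul_pow,
          h2 G (Finset.insert_erase hG).symm]
        simp
      · rw [hz.1 G hcard, hc, map_zero, smul_zero]
        rw [Finset.card_erase_of_mem hG, Nat.cast_sub (Finset.card_pos.2 ⟨j, hG⟩)]
        simpa using hcard
    · intro l hl hlj
      rw [hcj _ (Finset.mem_erase.2 ⟨hlj.symm, hG⟩), map_zero, smul_zero]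
  refine ⟨c, hc, ?_⟩
  set e := z - cechDifferential k n (FaceRing k x) c with he
  have heα : ∀ F, e F ∈ cechTermGrading k (FaceRing.grading k x) F α := fun F =>
    Submodule.sub_mem _ (hzα F) (cechDifferential_mem_grading hcα F)
  have hej : ∀ F, j ∈ F → e F = 0 := fun F hF => sub_eq_zero.2 (hdc F hF).symm
  have hde : cechDifferential k n (FaceRing k x) e = 0 := by
    rw [he, map_sub, cechDifferential_cechDifferential, sub_zero]
    exact hz.2
  suffices e = 0 from (sub_eq_zero.1 this).symm
  ext F : 1
  by_cases hF : j ∈ F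
  · exact hej F hF
  · have h1 := congrFun hde (insert j F)
    rw [cechDifferential_apply, Finset.sum_eq_single_of_mem j (Finset.mem_insert_self j F)] at h1
    · have h2 : ∀ F', F' = F → ∀ h : F' ⊆ insert j F, cechRes k (FaceRing k x) h (e F') = 0 →
          e F = 0 := by
        rintro _ rfl h h0
        exact eq_zero_of_cechRes_eq_zero hP h subset_rfl hj (heα _) h0
      refine h2 _ (Finset.erase_insert hF) (Finset.erase_subset _ _) ?_
      exact (smul_eq_zero_iff_right (pow_ne_zero _ (neg_ne_zero.2 one_ne_zero))).1 h1
    · intro l hl hlj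
      rw [hej _ (Finset.mem_erase.2 ⟨hlj.symm, Finset.mem_insert_self j F⟩), map_zero, smul_zero]

end Vanishing

/-! ### Passage to cohomology and the module structure -/

section Cohomology

theorem le_of_mem_relCochains {k : Type*} [Field k] {P : Type*} [PartialOrder P] {w : P} {i : ℤ}
    {f : P → k} (hf : f ∈ relCochains k (cost w) i) {y : P} (hy : f y ≠ 0) : w ≤ y :=
  not_not.1 (hf y hy).1

variable {k : Type*} [Field k] {P : Type*} [PartialOrder P] [OrderBot P] [Fintype P] {n : ℕ}
  {x : Fin n ≃ {a : P // IsAtom a}}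

/-- Classes of homogeneous cocycles already form a subspace, so taking the span adds nothing. -/
theorem exists_cocycle_of_mem_degree {i : ℤ} {α : Fin n → ℤ} {h : FaceLocalCohomology k x i}
    (hh : h ∈ faceLocalCohomologyDegree k x i α) :
    ∃ z : cechCocycles k n (FaceRing k x) i,
      (∀ F, (z : CechTotal k n (FaceRing k x)) F ∈
        cechTermGrading k (FaceRing.grading k x) F α) ∧ Submodule.Quotient.mk z = h := by
  induction hh using Submodule.span_induction with
  | mem h hh => exact hh
  | zero => exact ⟨0, fun F => Submodule.zero_mem _, rfl⟩
  | add a b _ _ ha hb =>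
    obtain ⟨z, hz, rfl⟩ := ha
    obtain ⟨z', hz', rfl⟩ := hb
    exact ⟨z + z', fun F => Submodule.add_mem _ (hz F) (hz' F), rfl⟩
  | smul r a _ ha =>
    obtain ⟨z, hz, rfl⟩ := ha
    exact ⟨r • z, fun F => Submodule.smul_mem _ _ (hz F), rfl⟩

theorem faceLocalCohomologyDegree_eq_bot (hP : IsSimplicialPoset P)
    (x : Fin n ≃ {a : P // IsAtom a}) (i : ℤ) {α : Fin n → ℤ} (hα : ¬ α ≤ 0) :
    faceLocalCohomologyDegree k x i α = ⊥ := by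
  obtain ⟨j, hj⟩ : ∃ j, 0 < α j := by
    by_contra! h
    exact hα h
  refine (Submodule.eq_bot_iff _).2 fun h hh => ?_
  obtain ⟨z, hz, rfl⟩ := exists_cocycle_of_mem_degree hh
  exact (Submodule.Quotient.mk_eq_zero _).2 (exists_cechDifferential_eq hP hj z.2 hz)

theorem X_smul_mem_degree {i : ℤ} {α : Fin n → ℤ} (j : Fin n) {h : FaceLocalCohomology k x i}
    (hh : h ∈ faceLocalCohomologyDegree k x i α) :
    (X j : MvPolynomial (Fin n) k) • h ∈
      faceLocalCohomologyDegree k x i (α + Pi.single j 1) := by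
  obtain ⟨z, hz, rfl⟩ := exists_cocycle_of_mem_degree hh
  refine Submodule.subset_span ⟨(X j : MvPolynomial (Fin n) k) • z, fun F => ?_, rfl⟩
  change (X j : MvPolynomial (Fin n) k) • ((z : CechTotal k n (FaceRing k x)) F) ∈ _
  have hzF := hz F
  generalize (z : CechTotal k n (FaceRing k x)) F = u at hzF
  induction hzF using Submodule.span_induction with
  | zero => rw [smul_zero]; exact Submodule.zero_mem _
  | add a b _ _ ha hb => rw [smul_add]; exact Submodule.add_mem _ ha hb
  | smul r a _ ha => rw [smul_comm]; exact Submodule.smul_mem _ _ ha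
  | mem u hu =>
    obtain ⟨β, hβ, m, hm, hum⟩ := hu
    refine Submodule.subset_span ⟨β, hβ, (X j : MvPolynomial (Fin n) k) • m, ?_, ?_⟩
    · change (monomial (Finsupp.single j 1) 1 : MvPolynomial (Fin n) k) • m ∈ _
      convert monomial_smul_mem_grading (Finsupp.single j 1) hm using 2
      ext l
      by_cases hjl : j = l
      · subst hjl
        simp
        ring
      · simp [Ne.symm hjl]
    · rw [smul_comm, hum, map_smul]

variable (O : VertexOrientation x)

theorem toCech_mem_cochains (hP : IsSimplicialPoset P) {w : P} {i : ℤ} (α : Fin n → ℤ) {f : P → k}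
    (hf : f ∈ relCochains k (cost w) (i - 1)) :
    toCech O k α f ∈ cechCochains k n (FaceRing k x) i := by
  intro F hF
  rw [toCech_apply]
  refine Finset.sum_eq_zero fun y hy => ?_
  have : f y = 0 := by
    by_contra h
    have h1 := (hf y h).2
    rw [rk_eq_card_supp hP x, (Finset.mem_filter.1 hy).2] at h1
    exact hF (by omega)
  rw [this, mul_zero, zero_smul]

theorem toCech_mem_cocycles (hP : IsSimplicialPoset P) {w : P} {i : ℤ} {α : Fin n → ℤ}
    (hw : supp x w = degSupp α) {f : P → k} (hf : f ∈ relCocycles k O (cost w) (i - 1)) :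
    toCech O k α f ∈ cechCocycles k n (FaceRing k x) i := by
  refine ⟨toCech_mem_cochains O hP α hf.1, ?_⟩
  have h : coboundary k O f = 0 := hf.2
  change cechDifferential k n (FaceRing k x) (toCech O k α f) = 0
  rw [cechDifferential_toCech O hP, h, map_zero]
  exact fun y hy => hw ▸ supp_mono (le_of_mem_relCochains hf.1 hy)

theorem ofCech_mem_relCochains (hP : IsSimplicialPoset P) (w : P) {i : ℤ} (α : Fin n → ℤ)
    {c : CechTotal k n (FaceRing k x)} (hc : c ∈ cechCochains k n (FaceRing k x) (i + 1)) :
    ofCech O hP α w c ∈ relCochains k (cost w) i := by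
  intro y hy
  rw [ofCech_apply O hP α w c rfl] at hy
  split_ifs at hy with h
  · refine ⟨not_not.2 h, ?_⟩
    by_contra hcard
    rw [rk_eq_card_supp hP x] at hcard
    rw [hc _ hcard, map_zero, map_zero, mul_zero] at hy
    exact hy rfl
  · exact absurd rfl hy

/-- The map from relative cocycles to classes in the local cohomology in degree `α`. -/
def cocycleClass (hP : IsSimplicialPoset P) {w : P} (i : ℤ) {α : Fin n → ℤ}
    (hw : supp x w = degSupp α) :
    relCocycles k O (cost w) (i - 1) →ₗ[k] FaceLocalCohomology k x i where
  toFun f := Submodule.Quotient.mk ⟨toCech O k α f, toCech_mem_cocycles O hP hw f.2⟩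
  map_add' f g := congrArg Submodule.Quotient.mk (Subtype.ext (map_add (toCech O k α) f.1 g.1))
  map_smul' r f := congrArg Submodule.Quotient.mk (Subtype.ext (map_smul (toCech O k α) r f.1))

variable (k) in
/-- The map from relative cohomology to local cohomology in degree `α`. -/
def relToLocal (hP : IsSimplicialPoset P) {w : P} (i : ℤ) {α : Fin n → ℤ}
    (hw : supp x w = degSupp α) :
    RelCohomology k O (cost w) (i - 1) →ₗ[k] FaceLocalCohomology k x i :=
  Submodule.liftQ _ (cocycleClass O hP i hw) (by
    rintro ⟨f, hf⟩ ⟨g, hg, hgf⟩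
    have hgf : coboundary k O g = f := hgf
    refine (Submodule.Quotient.mk_eq_zero _).2 ⟨toCech O k α g, ?_, ?_⟩
    · exact toCech_mem_cochains O hP α hg
    · rw [cechDifferential_toCech O hP, hgf]
      · rfl
      · exact fun y hy => hw ▸ supp_mono (le_of_mem_relCochains hg hy))

open Classical in
variable (k) in
/-- The map from the direct sum of the relative cohomologies to local cohomology in degree `α`. -/
def costSumToLocal (hP : IsSimplicialPoset P) (i : ℤ) (α : Fin n → ℤ) :
    CostSum k O (degSupp α) (i - 1) →ₗ[k] FaceLocalCohomology k x i :=
  DirectSum.toModule k {w : P // supp x w = degSupp α} (FaceLocalCohomology k x i)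
    fun w => relToLocal k O hP i w.2

theorem costSumToLocal_of (hP : IsSimplicialPoset P) {w : P} {i : ℤ} {α : Fin n → ℤ}
    (hw : supp x w = degSupp α) (c : RelCohomology k O (cost w) (i - 1)) :
    costSumToLocal k O hP i α (CostSum.of k O w hw c) = relToLocal k O hP i hw c := by
  classical
  exact DirectSum.toModule_lof k
    (M := fun w : {w : P // supp x w = degSupp α} => RelCohomology k O (cost (w : P)) (i - 1))
    ⟨w, hw⟩ c

open Classical in
theorem exists_sum_of (i : ℤ) {S : Finset (Fin n)} (c : CostSum k O S i) :
    ∃ f : ∀ w : {w : P // supp x w = S}, relCocycles k O (cost (w : P)) i,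
      c = ∑ w, CostSum.of k O w.1 w.2 (Submodule.Quotient.mk (f w)) := by
  have h : ∀ w : {w : P // supp x w = S}, ∃ f : relCocycles k O (cost (w : P)) i,
      Submodule.Quotient.mk f = c w := fun w => Submodule.Quotient.mk_surjective _ (c w)
  choose f hf using h
  refine ⟨f, ?_⟩
  simp only [hf]
  exact (DirectSum.sum_univ_of c).symm

open Classical in
theorem costSumToLocal_sum (hP : IsSimplicialPoset P) (i : ℤ) {α : Fin n → ℤ}
    (f : ∀ w : {w : P // supp x w = degSupp α}, relCocycles k O (cost (w : P)) (i - 1)) :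
    costSumToLocal k O hP i α (∑ w, CostSum.of k O w.1 w.2 (Submodule.Quotient.mk (f w))) =
      Submodule.Quotient.mk (∑ w, ⟨toCech O k α (f w), toCech_mem_cocycles O hP w.2 (f w).2⟩) := by
  rw [map_sum]
  simp only [costSumToLocal_of]
  exact (map_sum (Submodule.mkQ ((cechCoboundaries k n (FaceRing k x) i).submoduleOf
    (cechCocycles k n (FaceRing k x) i))) _ _).symm

theorem costSumToLocal_injective (hP : IsSimplicialPoset P) (i : ℤ) {α : Fin n → ℤ} (hα : α ≤ 0) :
    Function.Injective (costSumToLocal k O hP i α) := by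
  classical
  intro c c' hc
  obtain ⟨f, rfl⟩ := exists_sum_of O (i - 1) c
  obtain ⟨f', rfl⟩ := exists_sum_of O (i - 1) c'
  rw [costSumToLocal_sum, costSumToLocal_sum, Submodule.Quotient.eq, ← Finset.sum_sub_distrib] at hc
  obtain ⟨b, hb, hdb⟩ := hc
  have hdb : cechDifferential k n (FaceRing k x) b =
      toCech O k α (∑ w : {w : P // supp x w = degSupp α},
        ((f w - f' w : relCocycles k O (cost (w : P)) (i - 1)) : P → k)) := by
    rw [hdb, map_sum, map_sum]
    exact Finset.sum_congr rfl fun w _ => (map_sub (toCech O k α) (f w).1 (f' w).1).symm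
  refine Finset.sum_congr rfl fun w _ => ?_
  have h0 : (Submodule.Quotient.mk (f w) : RelCohomology k O (cost (w : P)) (i - 1)) =
      Submodule.Quotient.mk (f' w) := by
    -- The Čech primitive `b` need not be homogeneous: `ofCech` extracts its degree `α` part above
    -- `w`.
    refine (Submodule.Quotient.eq _).2 ⟨ofCech O hP α w b, ?_, ?_⟩
    · refine ofCech_mem_relCochains O hP w.1 α ?_
      rwa [sub_add_cancel]
    · rw [← ofCech_cechDifferential O hα w.2, hdb]
      ext y
      rw [ofCech_toCech O hα w.2]
      split_ifs with h
      · rw [Finset.sum_apply, Finset.sum_eq_single w]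
        · rfl
        -- A face above `w` lies above no other face with the same support, so the remaining
        -- summands vanish there.
        · intro v _ hv
          by_contra hne
          exact hv (Subtype.ext (eq_of_supp_eq hP (le_of_mem_relCochains (f v - f' v).2.1 hne) h
            (v.2.trans w.2.symm)))
        · simp
      · by_contra hne
        exact h (le_of_mem_relCochains (f w - f' w).2.1 (Ne.symm hne))
  rw [h0]

theorem range_costSumToLocal (hP : IsSimplicialPoset P) (i : ℤ) {α : Fin n → ℤ} (hα : α ≤ 0) :
    LinearMap.range (costSumToLocal k O hP i α) = faceLocalCohomologyDegree k x i α := by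
  classical
  apply le_antisymm
  · rintro _ ⟨c, rfl⟩
    obtain ⟨f, rfl⟩ := exists_sum_of O (i - 1) c
    rw [costSumToLocal_sum]
    refine Submodule.subset_span ⟨_, fun F => ?_, rfl⟩
    rw [AddSubmonoidClass.coe_finsetSum, Finset.sum_apply]
    refine Submodule.sum_mem _ fun w _ => ?_
    change toCech O k α (f w : P → k) F ∈ _
    rw [toCech_apply]
    refine Submodule.sum_mem _ fun y hy => ?_
    by_cases h0 : (f w : P → k) y = 0
    · rw [h0, mul_zero, zero_smul]
      exact Submodule.zero_mem _
    · refine Submodule.smul_mem _ _ ?_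
      have hy' := (Finset.mem_filter.1 hy).2
      refine faceFrac_mem_grading hα hy' ?_
      rw [← w.2, ← hy']
      exact supp_mono (le_of_mem_relCochains (f w).2.1 h0)
  · intro h hh
    obtain ⟨z, hz, rfl⟩ := exists_cocycle_of_mem_degree hh
    -- A homogeneous cocycle is recovered exactly, not just up to a coboundary, from its simplicial
    -- parts.
    have hsum := eq_sum_toCech_ofCech O hα hP hz
    have hf : ∀ w : {w : P // supp x w = degSupp α},
        ofCech O hP α w.1 (z : CechTotal k n (FaceRing k x)) ∈
          relCocycles k O (cost (w : P)) (i - 1) := fun w => by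
      refine ⟨ofCech_mem_relCochains O hP w.1 α (by rw [sub_add_cancel]; exact z.2.1), ?_⟩
      have hdz : cechDifferential k n (FaceRing k x) z = 0 := z.2.2
      change coboundary k O (ofCech O hP α w.1 (z : CechTotal k n (FaceRing k x))) = 0
      rw [← ofCech_cechDifferential O hα w.2, hdz, map_zero]
    refine ⟨_, (costSumToLocal_sum O hP i fun w => ⟨_, hf w⟩).trans ?_⟩
    congr 1
    ext1
    rw [AddSubmonoidClass.coe_finsetSum]
    change ∑ w : {w : P // supp x w = degSupp α}, toCech O k α (ofCech O hP α w.1 z.1) = z.1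
    rw [← map_sum, ← Finset.sum_subtype {w | supp x w = degSupp α} (by simp)
      (fun w => ofCech O hP α w z.1)]
    exact hsum.symm

/-- On representatives, `x_j` turns each `faceFrac` of degree `α` into the one of degree `γ` and
keeps the function `f`. The cases `α_j = -1` and `α_j < -1` (where `z = w`) are covered together. -/
theorem X_smul_relToLocal (hP : IsSimplicialPoset P) {w z : P} (hzw : z ≤ w) (i : ℤ)
    {α γ : Fin n → ℤ} {j : Fin n} (hγ : γ = α + Pi.single j 1) (hj : α j < 0)
    (hw : supp x w = degSupp α) (hz : supp x z = degSupp γ)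
    (c : RelCohomology k O (cost w) (i - 1)) :
    (X j : MvPolynomial (Fin n) k) • relToLocal k O hP i hw c =
      relToLocal k O hP i hz (relMap k O (cost_mono hzw) (i - 1) c) := by
  obtain ⟨f, rfl⟩ := Submodule.Quotient.mk_surjective _ c
  change Submodule.Quotient.mk ((X j : MvPolynomial (Fin n) k) •
    (⟨toCech O k α f, toCech_mem_cocycles O hP hw f.2⟩ : cechCocycles k n (FaceRing k x) i)) =
    Submodule.Quotient.mk ⟨toCech O k γ f, _⟩
  congr 1
  ext F : 2
  change (X j : MvPolynomial (Fin n) k) • toCech O k α (f : P → k) F = toCech O k γ (f : P → k) F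
  rw [toCech_apply, toCech_apply, Finset.smul_sum]
  refine Finset.sum_congr rfl fun y hy => ?_
  rw [smul_comm]
  by_cases h0 : (f : P → k) y = 0
  · rw [h0, mul_zero, zero_smul, zero_smul]
  · have hjF : j ∈ F := by
      rw [← (Finset.mem_filter.1 hy).2]
      refine supp_mono (le_of_mem_relCochains f.2.1 h0) ?_
      rw [hw]
      exact mem_degSupp.2 hj.ne
    rw [X_smul_faceFrac hjF hγ hj]

theorem relMap_self {w : P} (i : ℤ) (c : RelCohomology k O (cost w) i) :
    relMap k O (cost_mono le_rfl) i c = c := by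
  obtain ⟨f, rfl⟩ := Submodule.Quotient.mk_surjective _ c
  rfl

end Cohomology

end

end SimplicialPoset

open SimplicialPoset

theorem theorem4p4 {k : Type*} [Field k] {P : Type*} [PartialOrder P] [OrderBot P] [Fintype P]
    (hP : IsSimplicialPoset P) {n : ℕ} (x : Fin n ≃ {a : P // IsAtom a}) (O : VertexOrientation x)
    (i : ℤ) :
    -- vanishing outside of the nonpositive orthant
    (∀ α : Fin n → ℤ, ¬ α ≤ 0 → faceLocalCohomologyDegree k x i α = ⊥) ∧
    -- isomorphisms in the nonpositive orthant
    ∃ Φ : ∀ α : Fin n → ℤ, α ≤ 0 →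
        (faceLocalCohomologyDegree k x i α ≃ₗ[k] CostSum k O (degSupp α) (i - 1)),
      -- `α j < -1`: multiplication by `x_j` is the identity on every summand
      (∀ (α γ : Fin n → ℤ) (j : Fin n) (hα : α ≤ 0) (hγ : γ ≤ 0),
        γ = α + Pi.single j 1 → α j < -1 →
        ∀ (w : P) (hw : supp x w = degSupp α) (hw' : supp x w = degSupp γ)
          (c : RelCohomology k O (cost w) (i - 1)),
          (MvPolynomial.X j : MvPolynomial (Fin n) k) •
              ((Φ α hα).symm (CostSum.of k O w hw c) : FaceLocalCohomology k x i) =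
            (Φ γ hγ).symm (CostSum.of k O w hw' c)) ∧
      -- `α j = -1`: multiplication by `x_j` maps the summand of `w` to the summand of the face
      -- `z = w ∖ x_j` by the map induced by the inclusion of pairs
      (∀ (α γ : Fin n → ℤ) (j : Fin n) (hα : α ≤ 0) (hγ : γ ≤ 0),
        γ = α + Pi.single j 1 → α j = -1 →
        ∀ (w z : P) (hw : supp x w = degSupp α) (hz : supp x z = degSupp γ) (hzw : z ≤ w)
          (c : RelCohomology k O (cost w) (i - 1)),
          (MvPolynomial.X j : MvPolynomial (Fin n) k) •
              ((Φ α hα).symm (CostSum.of k O w hw c) : FaceLocalCohomology k x i) =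
            (Φ γ hγ).symm (CostSum.of k O z hz (relMap k O (cost_mono hzw) (i - 1) c))) ∧
      -- `α j ≥ 0`: multiplication by `x_j` is zero
      (∀ (α : Fin n → ℤ) (j : Fin n), 0 ≤ α j → ∀ h ∈ faceLocalCohomologyDegree k x i α,
          (MvPolynomial.X j : MvPolynomial (Fin n) k) • h = 0) := by
  refine ⟨fun α hα => faceLocalCohomologyDegree_eq_bot hP x i hα,
    fun α hα => ((LinearEquiv.ofInjective (costSumToLocal k O hP i α)
        (costSumToLocal_injective O hP i hα)).trans
      (LinearEquiv.ofEq _ _ (range_costSumToLocal O hP i hα))).symm, ?_, ?_, ?_⟩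
  · intro α γ j hα hγ hαγ hj w hw hw' c
    change (MvPolynomial.X j : MvPolynomial (Fin n) k) • costSumToLocal k O hP i α (CostSum.of k O w hw c) = costSumToLocal k O hP i γ (CostSum.of k O w hw' c)
    rw [costSumToLocal_of, costSumToLocal_of,
      X_smul_relToLocal O hP le_rfl i hαγ (by omega) hw hw', relMap_self]
  · intro α γ j hα hγ hαγ hj w z hw hz hzw c
    change (MvPolynomial.X j : MvPolynomial (Fin n) k) • costSumToLocal k O hP i α (CostSum.of k O w hw c) = costSumToLocal k O hP i γ
      (CostSum.of k O z hz (relMap k O (cost_mono hzw) (i - 1) c))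
    rw [costSumToLocal_of, costSumToLocal_of,
      X_smul_relToLocal O hP hzw i hαγ (by omega) hw hz]
  -- The product has degree `α + e_j`, whose `j`-th coordinate is positive, and that graded piece is
  -- zero.
  · intro α j hj h hh
    have h1 := X_smul_mem_degree j hh
    rw [faceLocalCohomologyDegree_eq_bot hP x i] at h1
    · exact (Submodule.mem_bot k).1 h1
    · intro hle
      have := hle j
      simp at this
      omega
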